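/- Let $X\neq\{0\}$ be a real or complex Banach space with scalar field $\mathbb{K}$. For a normed space $Y$ over $\mathbb{K}$ put $\Pi(Y)=\{(y^*,y)\in S_{Y^*}\times S_Y : y^*(y)=1\}$, where $S_Y$ and $S_{Y^*}$ are the unit spheres. For a bounded linear operator $T$ on $Y$ let $v(T)=\sup\{|y^*(Ty)| : (y^*,y)\in\Pi(Y)\}$ be its numerical radius; $T$ attains its numerical radius if $|y^*(Ty)|=v(T)$ for some $(y^*,y)\in\Pi(Y)$. Let $\mathcal{L}(X)$ be the space of bounded linear operators on $X$, $\mathcal{K}(X)$ its subspace of compact operators, $n(X)=\inf\{v(T) : T\in\mathcal{L}(X),\ \|T\|=1\}$ the numerical index of $X$, and $v_e(T)=\inf\{v(T-K) : K\in\mathcal{K}(X)\}$ the essential numerical radius of $T\in\mathcal{L}(X)$. If $n(X)>0$, then $v$ is a norm on $\mathcal{L}(X)$ equivalent to the operator norm, and $\mathcal{L}_v(X)$, $\mathcal{K}_v(X)$ denote $\mathcal{L}(X)$, $\mathcal{K}(X)$ equipped with the norm $v$. A closed subspace $J$ of a Banach space $E$ is an M-ideal in $E$ if $E^*=J^*\oplus_1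 J^\perp$, i.e. if the annihilator $J^\perp$ of $J$ in $E^*$ is the range of a bounded linear projection $P$ on $E^*$ with $\|\varphi\|=\|P\varphi\|+\|\varphi-P\varphi\|$ for all $\varphi\in E^*$. Theorem. Suppose that $n(X)>0$ and that $\mathcal{K}_v(X)$ is an M-ideal in $\mathcal{L}_v(X)$. (1) For every $T\in\mathcal{L}_v(X)$, if the adjoint $T^*\in\mathcal{L}(X^*)$ does not attain its numerical radius, then $v(T)=v_e(T)$. (2) The set of all $T\in\mathcal{L}_v(X)$ whose adjoint $T^*$ does not attain its numerical radius is nowhere dense in $\mathcal{L}_v(X)$. -/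

import Mathlib

noncomputable section

namespace NumericalRadius

/-- `Π(Y)`: the pairs `(y*, y)` in `S_{Y*} × S_Y` with `y*(y) = 1`. -/
def statePairs (𝕜 Y : Type*) [RCLike 𝕜] [NormedAddCommGroup Y] [NormedSpace 𝕜 Y] :
    Set (StrongDual 𝕜 Y × Y) :=
  {q | ‖q.1‖ = 1 ∧ ‖q.2‖ = 1 ∧ q.1 q.2 = 1}

section

variable {𝕜 Y : Type*} [RCLike 𝕜] [NormedAddCommGroup Y] [NormedSpace 𝕜 Y]

/-- The numerical radius `v(T) = sup {|y*(T y)| : (y*, y) ∈ Π(Y)}`. -/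
def numRadius (T : Y →L[𝕜] Y) : ℝ :=
  sSup ((fun q : StrongDual 𝕜 Y × Y => ‖q.1 (T q.2)‖) '' statePairs 𝕜 Y)

/-- `T` attains its numerical radius: the supremum defining `v(T)` is a maximum. -/
def AttainsNumRadius (T : Y →L[𝕜] Y) : Prop :=
  ∃ q ∈ statePairs 𝕜 Y, ‖q.1 (T q.2)‖ = numRadius T

/-- The essential numerical radius `v_e(T) = inf {v(T - K) : K compact}`. -/
def essNumRadius (T : Y →L[𝕜] Y) : ℝ :=
  sInf ((fun K : Y →L[𝕜] Y => numRadius (T - K)) '' {K | IsCompactOperator K})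

/-- The Banach space adjoint `T* : Y* → Y*`, `T* f = f ∘ T`. -/
def adjointOp (T : Y →L[𝕜] Y) : StrongDual 𝕜 Y →L[𝕜] StrongDual 𝕜 Y :=
  ContinuousLinearMap.precomp 𝕜 T

theorem adjointOp_apply (T : Y →L[𝕜] Y) (f : StrongDual 𝕜 Y) (y : Y) :
    adjointOp T f y = f (T y) := rfl

theorem norm_apply_le_of_mem {q : StrongDual 𝕜 Y × Y} (hq : q ∈ statePairs 𝕜 Y)
    (T : Y →L[𝕜] Y) : ‖q.1 (T q.2)‖ ≤ ‖T‖ := by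
  obtain ⟨h1, h2, -⟩ := hq
  calc ‖q.1 (T q.2)‖ ≤ ‖q.1‖ * ‖T q.2‖ := q.1.le_opNorm _
    _ ≤ ‖q.1‖ * (‖T‖ * ‖q.2‖) := by gcongr; exact T.le_opNorm _
    _ = ‖T‖ := by rw [h1, h2]; ring

theorem bddAbove_numRadius (T : Y →L[𝕜] Y) :
    BddAbove ((fun q : StrongDual 𝕜 Y × Y => ‖q.1 (T q.2)‖) '' statePairs 𝕜 Y) := by
  refine ⟨‖T‖, ?_⟩
  rintro _ ⟨q, hq, rfl⟩
  exact norm_apply_le_of_mem hq T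

theorem le_numRadius {q : StrongDual 𝕜 Y × Y} (hq : q ∈ statePairs 𝕜 Y) (T : Y →L[𝕜] Y) :
    ‖q.1 (T q.2)‖ ≤ numRadius T :=
  le_csSup (bddAbove_numRadius T) ⟨q, hq, rfl⟩

theorem numRadius_nonneg (T : Y →L[𝕜] Y) : 0 ≤ numRadius T := by
  refine Real.sSup_nonneg ?_
  rintro _ ⟨q, -, rfl⟩
  exact norm_nonneg _

theorem numRadius_le {T : Y →L[𝕜] Y} {c : ℝ} (hc : 0 ≤ c)
    (h : ∀ q ∈ statePairs 𝕜 Y, ‖q.1 (T q.2)‖ ≤ c) : numRadius T ≤ c := by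
  refine Real.sSup_le ?_ hc
  rintro _ ⟨q, hq, rfl⟩
  exact h q hq

theorem numRadius_add_le (S T : Y →L[𝕜] Y) :
    numRadius (S + T) ≤ numRadius S + numRadius T := by
  refine numRadius_le (add_nonneg (numRadius_nonneg S) (numRadius_nonneg T)) fun q hq => ?_
  have h : q.1 ((S + T) q.2) = q.1 (S q.2) + q.1 (T q.2) := by simp
  rw [h]
  exact (norm_add_le _ _).trans (add_le_add (le_numRadius hq S) (le_numRadius hq T))

theorem numRadius_smul (c : 𝕜) (T : Y →L[𝕜] Y) :
    numRadius (c • T) = ‖c‖ * numRadius T := by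
  unfold numRadius
  rw [← smul_eq_mul, ← Real.sSup_smul_of_nonneg (norm_nonneg c), ← Set.image_smul,
    Set.image_image]
  simp

end

/-- The numerical index `n(X) = inf {v(T) : ‖T‖ = 1}`. -/
def numIndex (𝕜 X : Type*) [RCLike 𝕜] [NormedAddCommGroup X] [NormedSpace 𝕜 X] : ℝ :=
  sInf ((fun T : X →L[𝕜] X => numRadius T) '' {T | ‖T‖ = 1})

/-- `L_v(X)`: a copy of the space of bounded operators on `X`, to be equipped with the
numerical radius (instead of the operator norm) as its norm and the resulting topology. -/
def OpV (𝕜 X : Type*) [RCLike 𝕜] [NormedAddCommGroup X] [NormedSpace 𝕜 X] : Type _ :=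
  X →L[𝕜] X

section

variable (𝕜 X : Type*) [RCLike 𝕜] [NormedAddCommGroup X] [NormedSpace 𝕜 X]

instance : AddCommGroup (OpV 𝕜 X) := inferInstanceAs (AddCommGroup (X →L[𝕜] X))

instance : Module 𝕜 (OpV 𝕜 X) := inferInstanceAs (Module 𝕜 (X →L[𝕜] X))

/-- The identity map from `L_v(X)` to the bounded operators on `X`. -/
def toOp : OpV 𝕜 X ≃ₗ[𝕜] (X →L[𝕜] X) := LinearEquiv.refl 𝕜 (X →L[𝕜] X)

instance : Norm (OpV 𝕜 X) := ⟨fun T => numRadius (toOp 𝕜 X T)⟩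

theorem opV_norm_def (T : OpV 𝕜 X) : ‖T‖ = numRadius (toOp 𝕜 X T) := rfl

theorem opV_core : SeminormedSpace.Core 𝕜 (OpV 𝕜 X) where
  norm_nonneg T := numRadius_nonneg _
  norm_smul c T := by simp only [opV_norm_def, map_smul, numRadius_smul]
  norm_triangle S T := by
    simp only [opV_norm_def, map_add]
    exact numRadius_add_le _ _

/-- In general `v` is only a seminorm; it is a norm equivalent to the operator norm as soon as
`n(X) > 0`. -/
instance : SeminormedAddCommGroup (OpV 𝕜 X) := SeminormedAddCommGroup.ofCore (opV_core 𝕜 X)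

instance : NormedSpace 𝕜 (OpV 𝕜 X) where
  norm_smul_le c T := ((opV_core 𝕜 X).norm_smul c T).le

/-- `K_v(X)`: the compact operators, as a subspace of `L_v(X)`. -/
def compactV : Submodule 𝕜 (OpV 𝕜 X) :=
  (compactOperator (RingHom.id 𝕜) X X).comap (toOp 𝕜 X).toLinearMap

theorem mem_compactV (T : OpV 𝕜 X) : T ∈ compactV 𝕜 X ↔ IsCompactOperator (toOp 𝕜 X T) :=
  Iff.rfl

end

/-- A closed subspace `J` of `E` is an M-ideal if its annihilator is an L-summand of `E*`, that is,
the range of a bounded projection `P` with `‖φ‖ = ‖P φ‖ + ‖φ - P φ‖` for all `φ`. (The kernel of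
`P` is then identified isometrically with `J*` by restriction to `J`, so that
`E* = J* ⊕₁ J^⊥`.) -/
def IsMIdeal {𝕜 E : Type*} [RCLike 𝕜] [SeminormedAddCommGroup E] [NormedSpace 𝕜 E]
    (J : Submodule 𝕜 E) : Prop :=
  IsClosed (J : Set E) ∧
    ∃ P : StrongDual 𝕜 E →L[𝕜] StrongDual 𝕜 E,
      (∀ φ, P (P φ) = P φ) ∧ (∀ φ, ‖φ‖ = ‖P φ‖ + ‖φ - P φ‖) ∧
        Set.range P = {φ | ∀ x ∈ J, φ x = 0}

end NumericalRadius

end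

open NumericalRadius

/-!
Write `E` for `L_v(X)`, `J` for `K_v(X)`, `P` for the L-projection of `E*` onto the annihilator of
`J`, and `z ⊗ f` for the functional `T ↦ z (T* f)` on `E`, where `z ∈ X**` and `f ∈ X*`
(`dualTensor`).

**Limits of states.** Choose states `(x*, x)` along which `|x* (T x)|` tends to `v(T)`, and pass to
weak-* limits `Φ ∈ E*`, `z ∈ X**`, `f ∈ X*` (`exists_limit_state`). Then `Φ 1 = 1`,
`|Φ T| = v(T)`, and `Φ = z ⊗ f` on `J`. If `P Φ ≠ 0`, additivity of the norm along `P` gives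
`v(T) ≤ v(T - K)` for every compact `K`. If `P Φ = 0`, then `Φ` is determined by its restriction
to `J`. Once it is known that `z f = ‖z‖ ‖f‖`, comparing norms on `J` gives `‖z‖ = ‖f‖ = z f = 1`,
so that `Φ = z ⊗ f` and `T*` attains its numerical radius at `(z, f)`, because
`v(T*) = v(T)` (`numRadius_adjointOp`).

**Alignment.** The identity `z f = ‖z‖ ‖f‖` follows by evaluating `Φ` at compact perturbations `S`
of the identity with `‖S‖ ≤ 1 + ε` and `Re (z (S* f)) ≥ ‖z‖ ‖f‖ - ε`; their existence is
`exists_re_apply_adjointOp_ge`. The M-ideal property yields, for every rank one contraction `L`, a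
compact `K` with `v(L + 1 - K) ≤ 1 + ε` that acts like the identity on a given functional in the
kernel of `P` (`IsLProjection.exists_mem_norm_le`). The resolvent `(1 - t (L - K))⁻¹` then has norm
at most `1 / (1 - t ε)`, and for `L = g ⊗ x` it changes `z f` to first order by
`t (z g * f x - z f + (B z) f)`, where `(B z) f = P (z ⊗ f) (1)` (`defect`).

**Removing the defect.** The operator `B` need not be known to vanish, but `‖z‖ ≤ ‖z + a B z‖` for
all real `a`, so that the steps `1 - b B` are isometric up to second order in `b`. Let `σ z` be the
supremum of `Re (z (S* f))` over compact perturbations `S` of the identity with norm tending to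
one. The first-order computation shows that `σ z ≤ σ (z + a (z - B z - w))` whenever
`‖w‖ ≤ ‖z‖` and `a ≥ 0`. Steering with `w` along segments while following the flow of `-B`, one can
go from any unit vector to any other one without losing anything in the limit (`le_of_transport`);
so `σ` is constant on the unit sphere of an infinite-dimensional `X**`, and its value is `‖f‖`.

**Nowhere density.** Operators with nonattaining adjoint satisfy `v(T) ≤ v(T - K)` for every
compact `K`. This is a closed condition, and it is destroyed by adding to `T` a small rank one
operator that increases the numerical radius.
-/

noncomputable section

namespace NumericalRadius

/-! ### Transport along the unit sphere -/

section Transport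

variable {Z : Type*} [NormedAddCommGroup Z] [NormedSpace ℝ Z]

/-- The multiplier `χ` of one transport step. For the norms `p`, `q` of two nearby points of the
path, `1 - χ` is `θ q / p` minus a second-order margin that absorbs error terms; hence `χ` is at
most `log p - log q`, up to second order in the mesh `δ`. -/
theorem exists_correction {δ θ p q : ℝ} (hδ0 : 0 < δ) (hδ1 : δ ≤ 1 / 1000) (hθ1 : θ ≤ 1)
    (hθ : 1 - θ ≤ δ ^ 2) (hp : 1 / 5 ≤ p) (hq : 1 / 5 ≤ q) (hq3 : q ≤ 3)
    (hd : |p - q| ≤ 2 * δ) :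
    ∃ χ : ℝ, (1 - χ) * p = θ * q - 100 * δ ^ 2 ∧ |χ| ≤ 11 * δ ∧
      χ ≤ Real.log p - Real.log q + 600 * δ ^ 2 := by
  have hp0 : 0 < p := by linarith
  have hq0 : 0 < q := by linarith
  have h5 : 0 ≤ (1 - θ) * q := mul_nonneg (by linarith) hq0.le
  have h6 : (1 - θ) * q ≤ δ ^ 2 * 3 := mul_le_mul hθ hq3 hq0.le (by positivity)
  have h7 : δ ^ 2 ≤ δ * (1 / 1000) := by rw [sq]; gcongr
  refine ⟨(p - θ * q + 100 * δ ^ 2) / p, by field_simp; ring, ?_, ?_⟩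
  · have hnum : |p - θ * q + 100 * δ ^ 2| ≤ 22 / 10 * δ := by
      rw [abs_le] at hd ⊢
      constructor <;> nlinarith [hd.1, hd.2, sq_nonneg δ]
    rw [abs_div, abs_of_pos hp0, div_le_iff₀ hp0]
    nlinarith
  · have h8 : 1 - q / p ≤ Real.log p - Real.log q := by
      rw [← Real.log_div hp0.ne' hq0.ne']
      have := Real.one_sub_inv_le_log_of_pos (div_pos hp0 hq0)
      rwa [inv_div] at this
    have h9 : (p - θ * q + 100 * δ ^ 2) / p =
        (1 - q / p) + ((1 - θ) * q + 100 * δ ^ 2) / p := by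
      field_simp; ring
    have h10 : ((1 - θ) * q + 100 * δ ^ 2) / p ≤ 600 * δ ^ 2 := by
      rw [div_le_iff₀ hp0]
      nlinarith [sq_nonneg δ]
    linarith

/-- A family of positively homogeneous functions `τ j` with `τ (j + 1) y ≤ τ j (y + (y - k) / m)`
for `‖k‖ ≤ θ ‖y‖` is almost monotone along a segment between unit vectors that stays away from the
origin, including its prolongation to twice its length. The segment is traversed in `m * M` steps
through points `y i`, and `k` is chosen so that `y (j + 1)` is sent to a multiple
`1 + χ / m` of `y j`. As `χ ≈ log ‖y (j + 1 + m)‖ - log ‖y (j + 1)‖`, the product of the multipliers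
telescopes, and it is close to `‖u'‖ / ‖u‖ = 1`. -/
theorem le_exp_mul_along_segment (τ : ℕ → Z → ℝ) {m M : ℕ} (hm : 0 < m) (hM : 1000 ≤ M)
    {θ : ℝ} (hθ1 : θ ≤ 1) (hθ : 1 - θ ≤ 1 / (M : ℝ) ^ 2)
    (h0 : ∀ j y, 0 ≤ τ j y)
    (h1 : ∀ j y (c : ℝ), 0 < c → τ j (c • y) = c * τ j y)
    (h2 : ∀ j < m * M, ∀ y k, ‖k‖ ≤ θ * ‖y‖ →
      τ (j + 1) y ≤ τ j (y + (1 / (m : ℝ)) • (y - k)))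
    {u u' : Z} (hu : ‖u‖ = 1) (hu' : ‖u'‖ = 1)
    (hc : ∀ s : ℝ, 0 ≤ s → s ≤ 2 → 1 / 5 ≤ ‖u + s • (u' - u)‖) :
    τ (m * M) u' ≤ Real.exp (610 / M) * τ 0 u := by
  have hmR : (0 : ℝ) < m := by exact_mod_cast hm
  have hMR : (1000 : ℝ) ≤ M := by exact_mod_cast hM
  obtain ⟨δ, hδ⟩ : ∃ δ : ℝ, δ = 1 / M := ⟨_, rfl⟩
  obtain ⟨a, ha⟩ : ∃ a : ℝ, a = 1 / m := ⟨_, rfl⟩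
  have hδ0 : 0 < δ := by rw [hδ]; positivity
  have hδ1 : δ ≤ 1 / 1000 := by rw [hδ]; gcongr
  have ha0 : 0 < a := by rw [ha]; positivity
  have ha1 : a ≤ 1 := by
    rw [ha, div_le_one hmR]; exact_mod_cast hm
  have ham : a * m = 1 := by rw [ha]; field_simp
  have hδM : δ * M = 1 := by rw [hδ]; field_simp
  have hθ' : 1 - θ ≤ δ ^ 2 := by rw [hδ, one_div, inv_pow, ← one_div]; exact hθ
  rw [← ha] at h2
  set v := u' - u with hv
  have hv2 : ‖v‖ ≤ 2 := by
    calc ‖v‖ ≤ ‖u'‖ + ‖u‖ := norm_sub_le _ _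
      _ = 2 := by rw [hu, hu']; norm_num
  obtain ⟨y, hy⟩ : ∃ y : ℕ → Z, ∀ i : ℕ, y i = u + ((i : ℝ) * a * δ) • v := ⟨_, fun _ => rfl⟩
  obtain ⟨ν, hν⟩ : ∃ ν : ℕ → ℝ, ∀ i, ν i = ‖y i‖ := ⟨_, fun _ => rfl⟩
  have hlip : ∀ i k : ℕ, |ν (i + k) - ν i| ≤ 2 * (k * a * δ) := by
    intro i k
    have hyy : y (i + k) - y i = (k * a * δ) • v := by
      simp only [hy]; push_cast; module
    calc |ν (i + k) - ν i| ≤ ‖y (i + k) - y i‖ := by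
          rw [hν, hν]; exact abs_norm_sub_norm_le _ _
      _ = (k * a * δ) * ‖v‖ := by
          rw [hyy, norm_smul, Real.norm_of_nonneg (by positivity)]
      _ ≤ (k * a * δ) * 2 := by gcongr
      _ = _ := by ring
  have hyN : y (m * M) = u' := by
    have : ((m * M : ℕ) : ℝ) * a * δ = 1 := by
      push_cast
      calc (m : ℝ) * M * a * δ = (a * m) * (δ * M) := by ring
        _ = 1 := by rw [ham, hδM]; ring
    rw [hy, this, hv]; module
  have hy0 : y 0 = u := by simp [hy]
  have hlow : ∀ i : ℕ, i ≤ m * M + m → 1 / 5 ≤ ν i := by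
    intro i hi
    rw [hν, hy]
    refine hc _ (by positivity) ?_
    have : (i : ℝ) ≤ m * M + m := by exact_mod_cast hi
    calc (i : ℝ) * a * δ ≤ (m * M + m) * a * δ := by gcongr
      _ = (a * m) * (δ * M) + (a * m) * δ := by ring
      _ ≤ 2 := by rw [ham, hδM]; linarith
  have hup : ∀ i : ℕ, i ≤ m * M → ν i ≤ 3 := by
    intro i hi
    have h := hlip 0 i
    have hi' : (i : ℝ) ≤ m * M := by exact_mod_cast hi
    have h3 : (i : ℝ) * a * δ ≤ 1 := by
      calc (i : ℝ) * a * δ ≤ (m * M) * a * δ := by gcongr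
        _ = (a * m) * (δ * M) := by ring
        _ = 1 := by rw [ham, hδM]; ring
    have h4 : ν 0 = 1 := by rw [hν, hy0, hu]
    rw [zero_add, h4] at h
    have := (abs_le.mp h).2
    linarith
  -- the logarithm of the telescoping product is a difference of averages over windows of length `m`
  obtain ⟨Ψ, hΨdef⟩ : ∃ Ψ : ℕ → ℝ,
      ∀ j, Ψ j = a * ∑ i ∈ Finset.range m, Real.log (ν (j + 1 + i)) := ⟨_, fun _ => rfl⟩
  have hΨ : ∀ j, Ψ (j + 1) = Ψ j + a * (Real.log (ν (j + 1 + m)) - Real.log (ν (j + 1))) := by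
    intro j
    have e1 := Finset.sum_range_succ (fun i => Real.log (ν (j + 1 + i))) m
    have e2 := Finset.sum_range_succ' (fun i => Real.log (ν (j + 1 + i))) m
    have e3 : ∑ i ∈ Finset.range m, Real.log (ν (j + 1 + (i + 1))) =
        ∑ i ∈ Finset.range m, Real.log (ν (j + 1 + 1 + i)) :=
      Finset.sum_congr rfl fun i _ => by rw [add_comm i 1, add_assoc (j + 1)]
    rw [e3, add_zero] at e2
    rw [hΨdef, hΨdef, ← mul_add]
    congr 1
    linarith
  have hstep : ∀ j < m * M, τ (j + 1) (y (j + 1)) ≤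
      Real.exp (a * (Real.log (ν (j + 1 + m)) - Real.log (ν (j + 1))) + a * (600 * δ ^ 2)) *
        τ j (y j) := by
    intro j hj
    have hν' : 1 / 5 ≤ ν (j + 1 + m) := hlow _ (by omega)
    have hν1 : 1 / 5 ≤ ν (j + 1) := hlow _ (by omega)
    have hν3 : ν (j + 1) ≤ 3 := hup _ (by omega)
    have hd : |ν (j + 1 + m) - ν (j + 1)| ≤ 2 * δ := by
      have := hlip (j + 1) m
      rwa [mul_comm (m : ℝ) a, ham, one_mul] at this
    obtain ⟨p, hp⟩ : ∃ p, p = ν (j + 1 + m) := ⟨_, rfl⟩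
    obtain ⟨q, hq⟩ : ∃ q, q = ν (j + 1) := ⟨_, rfl⟩
    rw [← hp, ← hq] at hd ⊢
    rw [← hp] at hν'
    rw [← hq] at hν1 hν3
    have hp0 : 0 < p := by linarith
    have hq0 : 0 < q := by linarith
    obtain ⟨χ, hχp, hχabs, hlog⟩ := exists_correction hδ0 hδ1 hθ1 hθ' hν' hν1 hν3 hd
    have hρ0 : 0 ≤ 1 - χ := by
      have := (abs_le.mp hχabs).2
      linarith
    have hχm : -1 / 2 ≤ χ := by
      have := (abs_le.mp hχabs).1
      linarith
    -- since `y` is affine, `(1 + a) y (j + 1) = y j + a y (j + 1 + m)`, which dictates this `k`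
    obtain ⟨k, hkdef⟩ : ∃ k, k = y (j + 1 + m) - χ • y j := ⟨_, rfl⟩
    have hk : k = (1 - χ) • y (j + 1 + m) + (χ * ((1 + a) * δ)) • v := by
      have e : ((j + 1 + m : ℕ) : ℝ) * a * δ = j * a * δ + (1 + a) * δ := by
        push_cast
        calc ((j : ℝ) + 1 + m) * a * δ = j * a * δ + (a * m + a) * δ := by ring
          _ = _ := by rw [ham]
      rw [hkdef, hy, hy, e]
      module
    have hknorm : ‖k‖ ≤ θ * ‖y (j + 1)‖ := by
      calc ‖k‖ ≤ ‖(1 - χ) • y (j + 1 + m)‖ + ‖(χ * ((1 + a) * δ)) • v‖ := by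
            rw [hk]; exact norm_add_le _ _
        _ = (1 - χ) * p + |χ| * ((1 + a) * δ) * ‖v‖ := by
            rw [norm_smul, norm_smul, Real.norm_of_nonneg hρ0, Real.norm_eq_abs, abs_mul,
              abs_of_pos (by positivity : 0 < (1 + a) * δ), hp, hν]
        _ ≤ (1 - χ) * p + 11 * δ * ((1 + 1) * δ) * 2 := by gcongr
        _ ≤ θ * q := by rw [hχp]; nlinarith [sq_nonneg δ]
        _ = θ * ‖y (j + 1)‖ := by rw [hq, hν]
    have hcomb : y (j + 1) + a • (y (j + 1) - k) = (1 + a * χ) • y j := by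
      have e : ((j + 1 + m : ℕ) : ℝ) * a * δ = j * a * δ + (1 + a) * δ := by
        push_cast
        calc ((j : ℝ) + 1 + m) * a * δ = j * a * δ + (a * m + a) * δ := by ring
          _ = _ := by rw [ham]
      rw [hkdef, hy (j + 1 + m), hy (j + 1), hy j, e]
      push_cast
      module
    have hpos : 0 < 1 + a * χ := by nlinarith
    calc τ (j + 1) (y (j + 1)) ≤ τ j (y (j + 1) + a • (y (j + 1) - k)) := h2 j hj _ _ hknorm
      _ = (1 + a * χ) * τ j (y j) := by rw [hcomb, h1 _ _ _ hpos]
      _ ≤ _ := by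
          refine mul_le_mul_of_nonneg_right ?_ (h0 _ _)
          calc 1 + a * χ ≤ Real.exp (a * χ) := by
                have := Real.add_one_le_exp (a * χ); linarith
            _ ≤ _ := Real.exp_le_exp.mpr (by nlinarith)
  have hind : ∀ j ≤ m * M, τ j (y j) ≤
      Real.exp (Ψ j - Ψ 0 + j * (a * (600 * δ ^ 2))) * τ 0 (y 0) := by
    intro j
    induction j with
    | zero => intro _; simp
    | succ j ih =>
      intro hj
      refine (hstep j (by omega)).trans ?_
      refine (mul_le_mul_of_nonneg_left (ih (by omega)) (Real.exp_pos _).le).trans (le_of_eq ?_)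
      rw [← mul_assoc, ← Real.exp_add, hΨ]
      push_cast
      ring_nf
  have hfin := hind (m * M) le_rfl
  rw [hyN, hy0] at hfin
  refine hfin.trans (mul_le_mul_of_nonneg_right (Real.exp_le_exp.mpr ?_) (h0 _ _))
  -- both windows lie within `δ` of an end point of the segment, where the norm is one
  have hshift : ∀ i < m, 2 * (((1 + i : ℕ) : ℝ) * a * δ) ≤ 2 * δ := by
    intro i hi
    have : ((1 + i : ℕ) : ℝ) ≤ m := by exact_mod_cast (by omega : 1 + i ≤ m)
    have : ((1 + i : ℕ) : ℝ) * a ≤ 1 := by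
      rw [← ham, mul_comm a]; gcongr
    nlinarith
  have hN1 : ν (m * M) = 1 := by rw [hν, hyN, hu']
  have h01 : ν 0 = 1 := by rw [hν, hy0, hu]
  have hΨN : Ψ (m * M) ≤ 2 * δ := by
    have : ∑ i ∈ Finset.range m, Real.log (ν (m * M + 1 + i)) ≤ m * (2 * δ) := by
      have := Finset.sum_le_card_nsmul (Finset.range m)
        (fun i => Real.log (ν (m * M + 1 + i))) (2 * δ) ?_
      · simpa [nsmul_eq_mul] using this
      intro i hi
      have hi := Finset.mem_range.mp hi
      have h := (abs_le.mp (hlip (m * M) (1 + i))).2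
      have h' := hshift i hi
      have hlo := hlow (m * M + (1 + i)) (by omega)
      rw [← add_assoc] at h hlo
      have := Real.log_le_sub_one_of_pos (by linarith : 0 < ν (m * M + 1 + i))
      linarith
    calc Ψ (m * M) ≤ a * (m * (2 * δ)) := by
          rw [hΨdef]; exact mul_le_mul_of_nonneg_left this ha0.le
      _ = _ := by rw [← mul_assoc, ham, one_mul]
  have hΨ0 : -(4 * δ) ≤ Ψ 0 := by
    have : m * (-(4 * δ)) ≤ ∑ i ∈ Finset.range m, Real.log (ν (0 + 1 + i)) := by
      have := Finset.card_nsmul_le_sum (Finset.range m)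
        (fun i => Real.log (ν (0 + 1 + i))) (-(4 * δ)) ?_
      · simpa [nsmul_eq_mul] using this
      intro i hi
      have hi := Finset.mem_range.mp hi
      have h := (abs_le.mp (hlip 0 (1 + i))).1
      have h' := hshift i hi
      rw [← add_assoc, h01] at h
      obtain ⟨x, hx⟩ : ∃ x, x = ν (0 + 1 + i) := ⟨_, rfl⟩
      rw [← hx] at h ⊢
      have hx1 : 1 - 2 * δ ≤ x := by linarith
      have hx0 : 0 < x := by linarith
      refine le_trans ?_ (Real.one_sub_inv_le_log_of_pos hx0)
      have : x⁻¹ ≤ 1 + 4 * δ := by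
        rw [inv_le_iff_one_le_mul₀ hx0]
        nlinarith
      linarith
    calc -(4 * δ) = a * (m * (-(4 * δ))) := by rw [← mul_assoc, ham, one_mul]
      _ ≤ Ψ 0 := by rw [hΨdef]; exact mul_le_mul_of_nonneg_left this ha0.le
  have hlast : ((m * M : ℕ) : ℝ) * (a * (600 * δ ^ 2)) = 600 * δ := by
    push_cast
    calc (m : ℝ) * M * (a * (600 * δ ^ 2)) = (a * m) * (δ * M) * (600 * δ) := by ring
      _ = _ := by rw [ham, hδM]; ring
  have : (610 : ℝ) / M = 610 * δ := by rw [hδ]; ring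
  rw [hlast, this]
  linarith

theorem exists_unit_far_from_span (hZ : ¬ FiniteDimensional ℝ Z) (u u' : Z) :
    ∃ p : Z, ‖p‖ = 1 ∧ ∀ c d : ℝ, 1 / 2 ≤ ‖p - (c • u + d • u')‖ := by
  let F : Submodule ℝ Z := Submodule.span ℝ {u, u'}
  have hF : FiniteDimensional ℝ F := FiniteDimensional.span_of_finite ℝ (by simp)
  have hFc : IsClosed (F : Set Z) := F.closed_of_finiteDimensional
  have hex : ∃ x : Z, x ∉ F := by
    by_contra! h
    have : F = ⊤ := eq_top_iff.mpr fun x _ => h x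
    rw [this] at hF
    exact hZ (Module.finite_def.mpr (Module.Finite.iff_fg.mp hF))
  obtain ⟨x, hx, hr⟩ := riesz_lemma hFc hex (by norm_num : (1 / 2 : ℝ) < 1)
  have hx0 : x ≠ 0 := fun h => hx (h ▸ F.zero_mem)
  have hxn : 0 < ‖x‖ := norm_pos_iff.mpr hx0
  refine ⟨‖x‖⁻¹ • x, by rw [norm_smul, norm_inv, norm_norm, inv_mul_cancel₀ hxn.ne'], ?_⟩
  intro c d
  have hmem : ‖x‖ • (c • u + d • u') ∈ F := F.smul_mem _
    (F.add_mem (F.smul_mem _ (Submodule.subset_span (by simp)))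
      (F.smul_mem _ (Submodule.subset_span (by simp))))
  have h := hr _ hmem
  have e : x - ‖x‖ • (c • u + d • u') = ‖x‖ • (‖x‖⁻¹ • x - (c • u + d • u')) := by
    rw [smul_sub, smul_inv_smul₀ hxn.ne']
  rw [e, norm_smul, norm_norm, mul_comm] at h
  exact le_of_mul_le_mul_left h hxn

/-- The norm is at least `|r| / 2` and at least `1 - 2 |r|`; both equal `1 / 5` at `|r| = 2 / 5`. -/
theorem le_norm_of_far {u p : Z} (hu : ‖u‖ = 1) (hp : ‖p‖ = 1)
    (h : ∀ c : ℝ, 1 / 2 ≤ ‖p - c • u‖) {r s : ℝ} (hrs : 1 - |r| ≤ |s|) :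
    1 / 5 ≤ ‖s • u + r • p‖ := by
  have h1 : |r| * (1 / 2) ≤ ‖s • u + r • p‖ := by
    rcases eq_or_ne r 0 with rfl | hr0
    · simp
    · have e : s • u + r • p = r • (p - (-(s / r)) • u) := by
        rw [smul_sub, smul_smul, mul_neg, mul_div_cancel₀ _ hr0]; module
      rw [e, norm_smul, Real.norm_eq_abs]
      exact mul_le_mul_of_nonneg_left (h _) (abs_nonneg _)
  have h2 : |s| - |r| ≤ ‖s • u + r • p‖ := by
    have := norm_sub_norm_le (s • u) (-(r • p))
    rw [sub_neg_eq_add, norm_neg, norm_smul, norm_smul, hu, hp, mul_one, mul_one] at this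
    exact this
  by_cases hr4 : |r| ≤ 2 / 5
  · linarith
  · linarith

/-- The lower bound on `z + b B z`, applied to `z - b B z`, gives an upper bound in which the
first-order term cancels. -/
theorem norm_sub_smul_bound (B : Z →L[ℝ] Z) (hB : ∀ (a : ℝ) z, ‖z‖ ≤ ‖z + a • B z‖)
    (b : ℝ) (z : Z) : ‖z - b • B z‖ ≤ (1 + (b * ‖B‖) ^ 2) * ‖z‖ := by
  calc ‖z - b • B z‖ ≤ ‖(z - b • B z) + b • B (z - b • B z)‖ := hB b _
    _ = ‖z - (b * b) • B (B z)‖ := by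
        congr 1; rw [map_sub, map_smul]; module
    _ ≤ ‖z‖ + ‖(b * b) • B (B z)‖ := norm_sub_le _ _
    _ = ‖z‖ + (b * b) * ‖B (B z)‖ := by
        rw [norm_smul, Real.norm_of_nonneg (mul_self_nonneg b)]
    _ ≤ ‖z‖ + (b * b) * (‖B‖ * (‖B‖ * ‖z‖)) := by
        have h1 : ‖B (B z)‖ ≤ ‖B‖ * (‖B‖ * ‖z‖) :=
          (B.le_opNorm _).trans (mul_le_mul_of_nonneg_left (B.le_opNorm z) (norm_nonneg _))
        have := mul_le_mul_of_nonneg_left h1 (mul_self_nonneg b)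
        linarith
    _ = _ := by ring

/-- Let `B` be an operator with `‖z‖ ≤ ‖z + a B z‖` for all real `a`, and let `σ ≥ 0` be positively
homogeneous with `σ z ≤ σ (z + a (z - B z - w))` whenever `a ≥ 0` and `‖w‖ ≤ ‖z‖`. In infinite
dimension, `σ` is then constant on the unit sphere. The drift `-B` is removed by composing `σ` with
powers of the almost isometric operator `U = 1 - B / (m + 1)`; what remains is the situation of
`le_exp_mul_along_segment`, used on two segments that meet at a unit vector far from the span of
both end points. -/
theorem le_of_transport [CompleteSpace Z] (hZ : ¬ FiniteDimensional ℝ Z) (B : Z →L[ℝ] Z)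
    (hB : ∀ (a : ℝ) z, ‖z‖ ≤ ‖z + a • B z‖) (σ : Z → ℝ) (h0 : ∀ z, 0 ≤ σ z)
    (h1 : ∀ z (c : ℝ), 0 < c → σ (c • z) = c * σ z)
    (h2 : ∀ z w (a : ℝ), 0 ≤ a → ‖w‖ ≤ ‖z‖ → σ z ≤ σ (z + a • (z - B z - w)))
    {z₀ z₁ : Z} (hz₀ : ‖z₀‖ = 1) (hz₁ : ‖z₁‖ = 1) : σ z₁ ≤ σ z₀ := by
  have key : ∀ M : ℕ, 1000 ≤ M →
      (1 - 1 / (M : ℝ) ^ 2) * σ z₁ ≤ Real.exp (1220 / M) * σ z₀ := by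
    intro M hM
    have hMR : (1000 : ℝ) ≤ M := by exact_mod_cast hM
    -- with so many steps the distortion `(1 + κ) ^ n` of `U ^ n` is `1 + O(1 / M ^ 2)`
    obtain ⟨m, hmβ⟩ := exists_nat_gt (2 * (M : ℝ) ^ 3 * ‖B‖ ^ 2 + ‖B‖ + 1)
    have hM3 : 0 ≤ 2 * (M : ℝ) ^ 3 * ‖B‖ ^ 2 := by positivity
    have hβ0 : 0 ≤ ‖B‖ := norm_nonneg _
    have hmR : (1 : ℝ) < m := by linarith
    have hm : 0 < m := by
      have : (0 : ℝ) < m := by linarith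
      exact_mod_cast this
    obtain ⟨b, hb⟩ : ∃ b : ℝ, b = 1 / (m + 1) := ⟨_, rfl⟩
    have hb0 : 0 < b := by rw [hb]; positivity
    have hbm : b ≤ 1 / m := by rw [hb]; gcongr; linarith
    obtain ⟨κ, hκ⟩ : ∃ κ : ℝ, κ = (b * ‖B‖) ^ 2 := ⟨_, rfl⟩
    have hκ0 : 0 ≤ κ := by rw [hκ]; positivity
    obtain ⟨n, hn⟩ : ∃ n : ℕ, n = m * M + m * M := ⟨_, rfl⟩
    have hnκ : n * κ ≤ 1 / (M : ℝ) ^ 2 := by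
      have hκm : κ ≤ ‖B‖ ^ 2 / m ^ 2 := by
        rw [hκ, mul_pow]
        calc b ^ 2 * ‖B‖ ^ 2 ≤ (1 / m) ^ 2 * ‖B‖ ^ 2 := by gcongr
          _ = _ := by ring
      calc n * κ ≤ n * (‖B‖ ^ 2 / m ^ 2) := by gcongr
        _ = 2 * (M : ℝ) ^ 3 * ‖B‖ ^ 2 / m / M ^ 2 := by
            rw [hn]; push_cast; field_simp; ring
        _ ≤ 1 / M ^ 2 := by
            gcongr
            rw [div_le_one (by linarith)]; linarith
    obtain ⟨θ, hθ⟩ : ∃ θ : ℝ, θ = ((1 + κ) ^ n)⁻¹ := ⟨_, rfl⟩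
    have hpow1 : 1 ≤ (1 + κ) ^ n := one_le_pow₀ (by linarith)
    have hpow0 : 0 < (1 + κ) ^ n := by linarith
    have hθ1 : θ ≤ 1 := by rw [hθ]; exact inv_le_one_of_one_le₀ hpow1
    have hθ2 : 1 - θ ≤ 1 / (M : ℝ) ^ 2 := by
      have e1 : (1 + κ) ^ n ≤ Real.exp (n * κ) := by
        rw [Real.exp_nat_mul]
        have := Real.add_one_le_exp κ
        gcongr
        linarith
      have e2 : Real.exp (-(n * κ)) ≤ θ := by
        rw [Real.exp_neg, hθ]; gcongr
      have e3 := Real.add_one_le_exp (-(n * κ))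
      linarith
    -- one step of size `b` of the flow with velocity field `-B`
    let U : Z →L[ℝ] Z := 1 - b • B
    have hU : ∀ z, U z = z - b • B z := fun z => rfl
    have hUlow : ∀ z, ‖z‖ ≤ ‖U z‖ := fun z => by
      have := hB (-b) z
      rwa [neg_smul, ← sub_eq_add_neg, ← hU] at this
    have hUup : ∀ z, ‖U z‖ ≤ (1 + κ) * ‖z‖ := fun z => by
      rw [hU, hκ]; exact norm_sub_smul_bound B hB b z
    have hUpow : ∀ (i : ℕ) z, (U ^ (i + 1)) z = U ((U ^ i) z) := fun i z => by
      rw [pow_succ']; rfl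
    have hUilow : ∀ (i : ℕ) z, ‖z‖ ≤ ‖(U ^ i) z‖ := by
      intro i
      induction i with
      | zero => intro z; simp
      | succ i ih => intro z; rw [hUpow]; exact (ih z).trans (hUlow _)
    have hUiup : ∀ (i : ℕ) z, ‖(U ^ i) z‖ ≤ (1 + κ) ^ i * ‖z‖ := by
      intro i
      induction i with
      | zero => intro z; simp
      | succ i ih =>
        intro z
        rw [hUpow, pow_succ', mul_assoc]
        exact (hUup _).trans (mul_le_mul_of_nonneg_left (ih z) (by linarith))
    have hunit : IsUnit (U ^ n) := by
      refine IsUnit.pow n (isUnit_one_sub_of_norm_lt_one ?_)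
      rw [norm_smul, Real.norm_of_nonneg hb0.le, hb, one_div, inv_mul_lt_iff₀ (by linarith)]
      linarith
    obtain ⟨W, hW⟩ := hunit
    -- the path starts at the point that the flow carries to `z₀`
    obtain ⟨y, hy⟩ : ∃ y, (U ^ n) y = z₀ := by
      refine ⟨(↑W⁻¹ : Z →L[ℝ] Z) z₀, ?_⟩
      rw [← hW, ← mul_apply_eq_comp, Units.mul_inv, one_apply_eq_self]
    have hyup : ‖y‖ ≤ 1 := by rw [← hz₀, ← hy]; exact hUilow n y
    have hylow : θ ≤ ‖y‖ := by
      have := hUiup n y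
      rw [hy, hz₀] at this
      rw [hθ, inv_le_iff_one_le_mul₀ hpow0, mul_comm]
      exact this
    have hθ0 : 0 < θ := by rw [hθ]; exact inv_pos.mpr hpow0
    have hy0 : 0 < ‖y‖ := hθ0.trans_le hylow
    let τ : ℕ → Z → ℝ := fun j x => σ ((U ^ (n - j)) x)
    have hτ0 : ∀ j x, 0 ≤ τ j x := fun j x => h0 _
    have hτ1 : ∀ j x (c : ℝ), 0 < c → τ j (c • x) = c * τ j x := fun j x c hc => by
      simp only [τ, map_smul]; exact h1 _ _ hc
    have hτ2 : ∀ j < n, ∀ x k, ‖k‖ ≤ θ * ‖x‖ →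
        τ (j + 1) x ≤ τ j (x + (1 / (m : ℝ)) • (x - k)) := by
      intro j hj x k hk
      obtain ⟨i, hi⟩ : ∃ i, n - (j + 1) = i := ⟨_, rfl⟩
      have hi' : n - j = i + 1 := by omega
      have hin : i + 1 ≤ n := by omega
      simp only [τ, hi, hi']
      have hk' : ‖(U ^ (i + 1)) k‖ ≤ ‖(U ^ i) x‖ := by
        calc ‖(U ^ (i + 1)) k‖ ≤ (1 + κ) ^ (i + 1) * ‖k‖ := hUiup _ _
          _ ≤ (1 + κ) ^ n * ‖k‖ := by
              gcongr
              linarith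
          _ ≤ (1 + κ) ^ n * (θ * ‖x‖) := by gcongr
          _ = ‖x‖ := by rw [hθ, ← mul_assoc, mul_inv_cancel₀ hpow0.ne', one_mul]
          _ ≤ _ := hUilow i x
      have h := h2 ((U ^ i) x) ((U ^ (i + 1)) k) (1 / m) (by positivity) hk'
      have e : (U ^ (i + 1)) (x + (1 / (m : ℝ)) • (x - k)) = (U ^ i) x +
          (1 / (m : ℝ)) • ((U ^ i) x - B ((U ^ i) x) - (U ^ (i + 1)) k) := by
        rw [map_add, map_smul, map_sub, hUpow i x, hU ((U ^ i) x)]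
        match_scalars <;> field_simp
        rw [hb]
        field_simp
        ring
      rw [e]
      exact h
    obtain ⟨p, hp, hfar⟩ := exists_unit_far_from_span hZ y z₁
    have hyn : ‖‖y‖⁻¹ • y‖ = 1 := by
      rw [norm_smul, norm_inv, norm_norm, inv_mul_cancel₀ hy0.ne']
    have leg1 : τ (m * M) p ≤ Real.exp (610 / M) * τ 0 (‖y‖⁻¹ • y) := by
      refine le_exp_mul_along_segment τ hm hM hθ1 hθ2 hτ0 hτ1
        (fun j hj => hτ2 j (by omega)) hyn hp fun s hs _ => ?_
      have h := le_norm_of_far (u := ‖y‖⁻¹ • y) hyn hp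
        (fun c => by simpa [smul_smul] using hfar (c * ‖y‖⁻¹) 0) (r := s) (s := 1 - s)
        (by have := abs_add_le s (1 - s); rw [add_sub_cancel, abs_one] at this; linarith)
      have e : ‖y‖⁻¹ • y + s • (p - ‖y‖⁻¹ • y) = (1 - s) • ‖y‖⁻¹ • y + s • p := by module
      rw [e]
      exact h
    have leg2 : τ (m * M + m * M) z₁ ≤ Real.exp (610 / M) * τ (m * M) p := by
      refine le_exp_mul_along_segment (fun j => τ (m * M + j)) hm hM hθ1 hθ2
        (fun j => hτ0 _) (fun j => hτ1 _) (fun j hj => hτ2 (m * M + j) (by omega))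
        hp hz₁ fun s hs _ => ?_
      have e : p + s • (z₁ - p) = s • z₁ + (1 - s) • p := by module
      have hfar' : ∀ c : ℝ, 1 / 2 ≤ ‖p - c • z₁‖ := fun c => by simpa using hfar 0 c
      rw [e]
      refine le_norm_of_far hz₁ hp hfar' ?_
      have := abs_add_le s (1 - s)
      rw [add_sub_cancel, abs_one] at this
      linarith
    have ez₁ : τ (m * M + m * M) z₁ = σ z₁ := by simp [τ, hn]
    have ez₀ : τ 0 (‖y‖⁻¹ • y) = ‖y‖⁻¹ * σ z₀ := by
      rw [hτ1 _ _ _ (inv_pos.mpr hy0)]; simp only [τ, Nat.sub_zero, hy]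
    rw [ez₀] at leg1
    rw [ez₁] at leg2
    have hall : σ z₁ ≤ Real.exp (1220 / M) * (‖y‖⁻¹ * σ z₀) := by
      calc σ z₁ ≤ Real.exp (610 / M) * (Real.exp (610 / M) * (‖y‖⁻¹ * σ z₀)) :=
            leg2.trans (mul_le_mul_of_nonneg_left leg1 (Real.exp_pos _).le)
        _ = _ := by rw [← mul_assoc, ← Real.exp_add]; ring_nf
    calc (1 - 1 / (M : ℝ) ^ 2) * σ z₁ ≤ ‖y‖ * σ z₁ :=
          mul_le_mul_of_nonneg_right (by linarith) (h0 _)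
      _ ≤ ‖y‖ * (Real.exp (1220 / M) * (‖y‖⁻¹ * σ z₀)) := by gcongr
      _ = _ := by field_simp
  have hl : Filter.Tendsto (fun M : ℕ => (1 - 1 / (M : ℝ) ^ 2) * σ z₁) Filter.atTop
      (nhds ((1 - 0) * σ z₁)) := by
    refine Filter.Tendsto.mul_const _ (Filter.Tendsto.const_sub _ ?_)
    have := tendsto_one_div_atTop_nhds_zero_nat (𝕜 := ℝ)
    simpa [one_div] using this.pow 2
  have hr : Filter.Tendsto (fun M : ℕ => Real.exp (1220 / M) * σ z₀) Filter.atTop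
      (nhds (Real.exp 0 * σ z₀)) := by
    refine Filter.Tendsto.mul_const _ ?_
    exact (Real.continuous_exp.tendsto 0).comp (tendsto_const_div_atTop_nhds_zero_nat 1220)
  have := le_of_tendsto_of_tendsto hl hr
    (Filter.eventually_atTop.mpr ⟨1000, fun M hM => key M hM⟩)
  simpa using this

end Transport

/-! ### L-projections onto an annihilator -/

section LProjection

variable {𝕜 E : Type*} [RCLike 𝕜] [SeminormedAddCommGroup E] [NormedSpace 𝕜 E]

/-- Separation in `E × 𝕜` of the product of the open balls of radii `1 + ε` and `ε` from the affine
set `{(L + e - K, φ (e - K)) | K ∈ J}`. -/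
theorem exists_separating_functional (J : Submodule 𝕜 E) (L e : E) (φ : StrongDual 𝕜 E) {ε : ℝ}
    (hε : 0 < ε) (hcon : ∀ K ∈ J, ‖L + e - K‖ ≤ 1 + ε → ε < ‖φ (e - K)‖) :
    ∃ (θ : StrongDual 𝕜 E) (c : 𝕜) (u : ℝ), 0 < u ∧
      (∀ x, ‖x‖ < 1 + ε → RCLike.re (θ x) < u) ∧
      ∀ K ∈ J, u ≤ RCLike.re (θ (L + e - K) + c * φ (e - K)) := by
  let _ : NormedSpace ℝ E := NormedSpace.restrictScalars ℝ 𝕜 E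
  have _ : IsScalarTower ℝ 𝕜 E := RestrictScalars.isScalarTower ℝ 𝕜 E
  let s : Set (E × 𝕜) := Metric.ball (0 : E) (1 + ε) ×ˢ Metric.ball (0 : 𝕜) ε
  let t : Set (E × 𝕜) := (fun K : E => (L + e - K, φ (e - K))) '' (J : Set E)
  have hs : Convex ℝ s := (convex_ball _ _).prod (convex_ball _ _)
  have hso : IsOpen s := Metric.isOpen_ball.prod Metric.isOpen_ball
  have ht : Convex ℝ t := by
    rintro _ ⟨K₁, hK₁, rfl⟩ _ ⟨K₂, hK₂, rfl⟩ a b ha hb hab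
    refine ⟨(a : 𝕜) • K₁ + (b : 𝕜) • K₂, J.add_mem (J.smul_mem _ hK₁) (J.smul_mem _ hK₂), ?_⟩
    have hab' : (a : 𝕜) + (b : 𝕜) = 1 := by exact_mod_cast congrArg (RCLike.ofReal (K := 𝕜)) hab
    have e1 : ∀ x : E × 𝕜, a • x = (a : 𝕜) • x := fun x => RCLike.real_smul_eq_coe_smul a x
    have e2 : ∀ x : E, x = ((a : 𝕜) + (b : 𝕜)) • x := fun x => by rw [hab', one_smul]
    rw [e1, RCLike.real_smul_eq_coe_smul (K := 𝕜) b]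
    refine Prod.ext ?_ ?_
    · simp only [Prod.fst_add, Prod.smul_fst]
      conv_lhs => rw [e2 (L + e)]
      module
    · simp only [Prod.snd_add, Prod.smul_snd, ← map_smul, ← map_add]
      conv_lhs => rw [e2 e]
      congr 1
      module
  have hdisj : Disjoint s t := by
    rw [Set.disjoint_left]
    rintro _ ⟨h1, h2⟩ ⟨K, hK, rfl⟩
    simp only [Metric.mem_ball, dist_zero_right] at h1 h2
    exact absurd h2.le (not_le.mpr (hcon K hK h1.le))
  obtain ⟨F, u, hFs, hFt⟩ := RCLike.geometric_hahn_banach_open (𝕜 := 𝕜) hs hso ht hdisj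
  refine ⟨F.comp (ContinuousLinearMap.inl 𝕜 E 𝕜), F (0, 1), u, ?_, ?_, ?_⟩
  · have h := hFs 0 ⟨by simp; linarith, by simpa using hε⟩
    rwa [map_zero, map_zero] at h
  · intro x hx
    exact hFs (x, 0) ⟨by simpa using hx, by simpa using hε⟩
  · intro K hK
    have h1 := hFt _ ⟨K, hK, rfl⟩
    have h2 : ∀ (x : E) (w : 𝕜), F (x, w) = F (x, 0) + F (0, 1) * w := by
      intro x w
      have : (x, w) = (x, (0 : 𝕜)) + w • ((0 : E), (1 : 𝕜)) := by simp
      rw [this, map_add, map_smul, smul_eq_mul, mul_comm]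
    rwa [h2] at h1

/-- `P` is an L-projection of `E*` onto the annihilator of `J`. -/
structure IsLProjection (J : Submodule 𝕜 E) (P : StrongDual 𝕜 E →L[𝕜] StrongDual 𝕜 E) : Prop where
  idem : ∀ φ, P (P φ) = P φ
  norm_eq : ∀ φ, ‖φ‖ = ‖P φ‖ + ‖φ - P φ‖
  range_eq : Set.range P = {φ | ∀ x ∈ J, φ x = 0}

namespace IsLProjection

variable {J : Submodule 𝕜 E} {P : StrongDual 𝕜 E →L[𝕜] StrongDual 𝕜 E}

theorem apply_eq_zero (h : IsLProjection J P) (φ : StrongDual 𝕜 E) {x : E} (hx : x ∈ J) :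
    P φ x = 0 := by
  have : P φ ∈ {φ : StrongDual 𝕜 E | ∀ x ∈ J, φ x = 0} := h.range_eq ▸ ⟨φ, rfl⟩
  exact this x hx

theorem apply_of_annihilates (h : IsLProjection J P) {b : StrongDual 𝕜 E}
    (hb : ∀ x ∈ J, b x = 0) : P b = b := by
  have : b ∈ Set.range P := by rw [h.range_eq]; exact hb
  obtain ⟨c, rfl⟩ := this
  exact h.idem c

theorem norm_add (h : IsLProjection J P) {b φ : StrongDual 𝕜 E} (hb : ∀ x ∈ J, b x = 0)
    (hφ : P φ = 0) : ‖b + φ‖ = ‖b‖ + ‖φ‖ := by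
  have := h.norm_eq (b + φ)
  rwa [map_add, hφ, h.apply_of_annihilates hb, add_zero, add_sub_cancel_left] at this

/-- A functional in the kernel of `P` is the only extension of its restriction to `J` that does not
increase the norm. -/
theorem eq_of_eqOn (h : IsLProjection J P) {φ ψ : StrongDual 𝕜 E} (hφ : P φ = 0)
    (heq : ∀ x ∈ J, ψ x = φ x) (hn : ‖ψ‖ ≤ ‖φ‖) : ψ = φ := by
  have h1 := h.norm_add (b := ψ - φ) (φ := φ) (fun x hx => by simp [heq x hx]) hφ
  rw [sub_add_cancel] at h1
  have h2 : ‖ψ - φ‖ = 0 := le_antisymm (by linarith) (norm_nonneg _)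
  ext x
  have h3 := (ψ - φ).le_opNorm x
  rw [h2, zero_mul] at h3
  exact sub_eq_zero.mp (norm_eq_zero.mp (le_antisymm h3 (norm_nonneg _)))

/-- A functional in the kernel of `P` has the same norm on `E` as on `J`. -/
theorem norm_le_of_bound (h : IsLProjection J P) {φ : StrongDual 𝕜 E} (hφ : P φ = 0) {r : ℝ}
    (hr : 0 ≤ r) (hb : ∀ x ∈ J, ‖φ x‖ ≤ r * ‖x‖) : ‖φ‖ ≤ r := by
  obtain ⟨g, hg, hgn⟩ := exists_extension_norm_eq J (φ.comp J.subtypeL)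
  have h1 : ‖g‖ ≤ r := by
    rw [hgn]
    exact ContinuousLinearMap.opNorm_le_bound _ hr fun x => hb x x.2
  have h2 := h.norm_add (b := g - φ) (φ := φ)
    (fun x hx => by have := hg ⟨x, hx⟩; simp at this; simp [this]) hφ
  rw [sub_add_cancel] at h2
  have := norm_nonneg (g - φ)
  linarith

/-- The approximation property of an M-ideal: `e` can be corrected by some `K ∈ J` such that, for a
given `L` in the unit ball of `J`, the norm of `L + e - K` is at most `1 + ε`, while `e - K` is
almost annihilated by a given `φ` in the kernel of `P`. Otherwise a separating functional `θ` would
be of the form `b - c φ` with `b ∈ J^⊥`, and `‖θ‖ = ‖b‖ + ‖c φ‖` would contradict the separation. -/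
theorem exists_mem_norm_le (h : IsLProjection J P) {L e : E} (hL : L ∈ J) (hL1 : ‖L‖ ≤ 1)
    (he : ‖e‖ ≤ 1) {φ : StrongDual 𝕜 E} (hφ : P φ = 0) {ε : ℝ} (hε : 0 < ε) :
    ∃ K ∈ J, ‖L + e - K‖ ≤ 1 + ε ∧ ‖φ (e - K)‖ ≤ ε := by
  by_contra! hcon
  obtain ⟨θ, c, u, hu0, hFs, hFt⟩ := exists_separating_functional J L e φ hε hcon
  obtain ⟨b, hb'⟩ : ∃ b : StrongDual 𝕜 E, ∀ x, b x = θ x + c * φ x :=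
    ⟨θ + c • φ, fun x => by simp⟩
  have hbt : ∀ K ∈ J, u ≤ RCLike.re (b (e - K)) + RCLike.re (θ L) := by
    intro K hK
    have := hFt K hK
    have e1 : θ (L + e - K) + c * φ (e - K) = b (e - K) + θ L := by
      rw [hb', map_sub, map_sub, map_sub, map_add]
      ring
    rwa [e1, map_add] at this
  -- `b` is bounded above on the subspace `J`, hence vanishes there
  have hb : ∀ x ∈ J, b x = 0 := by
    intro x hx
    by_contra hne
    obtain ⟨r, hr⟩ : ∃ r : ℝ, r = RCLike.re (b e) + RCLike.re (θ L) - u + 1 := ⟨_, rfl⟩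
    have := hbt (((r : 𝕜) * (b x)⁻¹) • x) (J.smul_mem _ hx)
    rw [map_sub, map_smul, smul_eq_mul, mul_assoc, inv_mul_cancel₀ hne, mul_one, map_sub,
      RCLike.ofReal_re] at this
    linarith
  have hθ : θ = b + -(c • φ) := by ext x; simp [hb']
  have hθn : ‖θ‖ = ‖b‖ + ‖c • φ‖ := by
    have := h.norm_add hb (φ := -(c • φ)) (by
      rw [map_neg, map_smul, hφ]; ext x; simp)
    rw [← hθ, norm_neg] at this
    exact this
  have huθ : u ≤ ‖θ‖ := by
    have h0 := hbt 0 J.zero_mem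
    rw [sub_zero] at h0
    have e1 : θ L = -((c • φ) L) := by
      have := hb L hL
      rw [hb'] at this
      exact eq_neg_of_add_eq_zero_left this
    have h1 : RCLike.re (b e) ≤ ‖b‖ :=
      (RCLike.re_le_norm _).trans ((b.le_opNorm e).trans
        (mul_le_of_le_one_right (norm_nonneg _) he))
    have h2 : RCLike.re (θ L) ≤ ‖c • φ‖ := by
      refine (RCLike.re_le_norm _).trans ?_
      rw [e1, norm_neg]
      exact ((c • φ).le_opNorm L).trans (mul_le_of_le_one_right (norm_nonneg _) hL1)
    linarith
  have hθ0 : 0 < ‖θ‖ := hu0.trans_le huθ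
  -- after rotating and stretching `x`, the bound on the ball of radius `1 + ε` controls `‖θ x‖`
  have hbound : ∀ x, ‖θ x‖ ≤ u / (1 + ε) * ‖x‖ := by
    intro x
    have hR : ∀ R, ‖x‖ < R → ‖θ x‖ ≤ u / (1 + ε) * R := by
      intro R hxR
      have hR0 : 0 < R := (norm_nonneg x).trans_lt hxR
      obtain ⟨d, hd, hdx⟩ := RCLike.exists_norm_eq_mul_self (θ x)
      have h1 : ‖(((1 + ε) / R : ℝ) : 𝕜) • d • x‖ < 1 + ε := by
        rw [norm_smul, norm_smul, hd, one_mul, RCLike.norm_ofReal, abs_of_pos (by positivity),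
          div_mul_eq_mul_div, div_lt_iff₀ hR0]
        gcongr
      have h2 := hFs _ h1
      rw [θ.map_smul, θ.map_smul, smul_eq_mul, smul_eq_mul, ← hdx, ← RCLike.ofReal_mul,
        RCLike.ofReal_re, div_mul_eq_mul_div, div_lt_iff₀ hR0] at h2
      rw [div_mul_eq_mul_div, le_div_iff₀ (by linarith)]
      linarith
    have hc : Filter.Tendsto (fun R => u / (1 + ε) * R) (nhdsWithin ‖x‖ (Set.Ioi ‖x‖))
        (nhds (u / (1 + ε) * ‖x‖)) :=
      ((continuous_const.mul continuous_id).tendsto ‖x‖).mono_left nhdsWithin_le_nhds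
    refine ge_of_tendsto hc ?_
    filter_upwards [self_mem_nhdsWithin] with R hxR using hR R hxR
  have hle : ‖θ‖ ≤ u / (1 + ε) :=
    ContinuousLinearMap.opNorm_le_bound _ (div_nonneg hu0.le (by linarith)) hbound
  rw [le_div_iff₀ (by linarith)] at hle
  nlinarith

end IsLProjection

end LProjection

/-! ### Numerical radius estimates -/

section Operators

variable {𝕜 X : Type*} [RCLike 𝕜] [NormedAddCommGroup X] [NormedSpace 𝕜 X]

theorem adjointOp_mul (S T : X →L[𝕜] X) (f : StrongDual 𝕜 X) :
    adjointOp (S * T) f = adjointOp T (adjointOp S f) := rfl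

theorem adjointOp_one (f : StrongDual 𝕜 X) : adjointOp (1 : X →L[𝕜] X) f = f := rfl

theorem adjointOp_add (S T : X →L[𝕜] X) (f : StrongDual 𝕜 X) :
    adjointOp (S + T) f = adjointOp S f + adjointOp T f := by
  ext y; simp [adjointOp_apply]

theorem adjointOp_sub (S T : X →L[𝕜] X) (f : StrongDual 𝕜 X) :
    adjointOp (S - T) f = adjointOp S f - adjointOp T f := by
  ext y; simp [adjointOp_apply]

theorem adjointOp_smul (c : 𝕜) (T : X →L[𝕜] X) (f : StrongDual 𝕜 X) :
    adjointOp (c • T) f = c • adjointOp T f := by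
  ext y; simp [adjointOp_apply]

theorem numIndex_mul_norm_le (T : X →L[𝕜] X) : numIndex 𝕜 X * ‖T‖ ≤ numRadius T := by
  rcases eq_or_ne T 0 with rfl | hT
  · simpa using numRadius_nonneg _
  have hT0 : 0 < ‖T‖ := norm_pos_iff.mpr hT
  have h1 : ‖((‖T‖⁻¹ : ℝ) : 𝕜) • T‖ = 1 := by
    rw [norm_smul, RCLike.norm_ofReal, abs_of_pos (inv_pos.mpr hT0), inv_mul_cancel₀ hT0.ne']
  have h2 : numIndex 𝕜 X ≤ numRadius (((‖T‖⁻¹ : ℝ) : 𝕜) • T) := by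
    refine csInf_le ⟨0, ?_⟩ ⟨_, h1, rfl⟩
    rintro _ ⟨S, -, rfl⟩
    exact numRadius_nonneg S
  rw [numRadius_smul, RCLike.norm_ofReal, abs_of_pos (inv_pos.mpr hT0)] at h2
  calc numIndex 𝕜 X * ‖T‖ ≤ ‖T‖⁻¹ * numRadius T * ‖T‖ := by gcongr
    _ = numRadius T := by field_simp

theorem numRadius_le_norm (T : X →L[𝕜] X) : numRadius T ≤ ‖T‖ :=
  numRadius_le (norm_nonneg _) fun _ hq => norm_apply_le_of_mem hq T

theorem exists_statePair (x : X) (hx : ‖x‖ = 1) :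
    ∃ g : StrongDual 𝕜 X, (g, x) ∈ statePairs 𝕜 X := by
  obtain ⟨g, hg, hgx⟩ := exists_dual_vector 𝕜 x (by rw [hx]; exact one_ne_zero)
  exact ⟨g, hg, hx, by rw [hgx, hx]; simp⟩

/-- An operator whose numerical range has real part at most `ε` is almost dissipative. -/
theorem le_norm_sub_smul {A : X →L[𝕜] X} {ε : ℝ}
    (hA : ∀ q ∈ statePairs 𝕜 X, RCLike.re (q.1 (A q.2)) ≤ ε) {t : ℝ} (ht : 0 ≤ t) (x : X) :
    (1 - t * ε) * ‖x‖ ≤ ‖x - (t : 𝕜) • A x‖ := by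
  rcases eq_or_ne x 0 with rfl | hx
  · simp
  have hx0 : 0 < ‖x‖ := norm_pos_iff.mpr hx
  obtain ⟨g, hg, hgx⟩ := exists_dual_vector 𝕜 x hx0.ne'
  have hq : (g, ((‖x‖⁻¹ : ℝ) : 𝕜) • x) ∈ statePairs 𝕜 X := by
    refine ⟨hg, ?_, ?_⟩
    · rw [norm_smul, RCLike.norm_ofReal, abs_of_pos (inv_pos.mpr hx0), inv_mul_cancel₀ hx0.ne']
    · rw [map_smul, hgx, smul_eq_mul, ← RCLike.ofReal_mul, inv_mul_cancel₀ hx0.ne',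
        RCLike.ofReal_one]
  have h1 := hA _ hq
  simp only [map_smul, smul_eq_mul, RCLike.re_ofReal_mul] at h1
  have h2 : RCLike.re (g (A x)) ≤ ε * ‖x‖ := by
    rw [inv_mul_le_iff₀ hx0] at h1; linarith
  calc (1 - t * ε) * ‖x‖ ≤ ‖x‖ - t * RCLike.re (g (A x)) := by nlinarith
    _ = RCLike.re (g (x - (t : 𝕜) • A x)) := by
        rw [map_sub, map_smul, hgx, smul_eq_mul, map_sub, RCLike.re_ofReal_mul, RCLike.ofReal_re]
    _ ≤ ‖g (x - (t : 𝕜) • A x)‖ := RCLike.re_le_norm _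
    _ ≤ ‖g‖ * ‖x - (t : 𝕜) • A x‖ := g.le_opNorm _
    _ = _ := by rw [hg, one_mul]

theorem re_apply_le_numRadius (T : X →L[𝕜] X) :
    ∀ q ∈ statePairs 𝕜 X, RCLike.re (q.1 (T q.2)) ≤ numRadius T := fun _ hq =>
  (RCLike.re_le_norm _).trans (le_numRadius hq T)

/-- The norm of `1 + t T` grows at rate `v(T)`: multiply by `1 - t T`, which is bounded below by
`le_norm_sub_smul`, and use that `(1 - t T) (1 + t T) = 1 - t ^ 2 T ^ 2`. -/
theorem norm_one_add_smul_le (T : X →L[𝕜] X) {t : ℝ} (ht : 0 ≤ t) (htv : t * numRadius T < 1) :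
    ‖(1 : X →L[𝕜] X) + (t : 𝕜) • T‖ ≤ (1 + t ^ 2 * ‖T‖ ^ 2) / (1 - t * numRadius T) := by
  have hpos : 0 < 1 - t * numRadius T := by linarith
  refine ContinuousLinearMap.opNorm_le_bound _ (by positivity) fun x => ?_
  rw [div_mul_eq_mul_div, le_div_iff₀ hpos, mul_comm]
  refine (le_norm_sub_smul (re_apply_le_numRadius T) ht _).trans ?_
  have e : ((1 : X →L[𝕜] X) + (t : 𝕜) • T) x - (t : 𝕜) • T (((1 : X →L[𝕜] X) + (t : 𝕜) • T) x)
      = x - ((t : 𝕜) * t) • T (T x) := by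
    simp only [add_apply, smul_apply, one_apply_eq_self, map_add, map_smul]
    module
  rw [e]
  calc ‖x - ((t : 𝕜) * t) • T (T x)‖ ≤ ‖x‖ + ‖((t : 𝕜) * t) • T (T x)‖ := norm_sub_le _ _
    _ = ‖x‖ + t * t * ‖T (T x)‖ := by
        rw [norm_smul, norm_mul, RCLike.norm_ofReal, abs_of_nonneg ht]
    _ ≤ ‖x‖ + t * t * (‖T‖ * (‖T‖ * ‖x‖)) := by
        gcongr
        exact T.le_opNorm_of_le (T.le_opNorm x)
    _ = _ := by ring

/-- The operator `R` is the inverse of `1 - t A`. -/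
theorem exists_resolvent [CompleteSpace X] {A : X →L[𝕜] X} {ε : ℝ}
    (hA : ∀ q ∈ statePairs 𝕜 X, RCLike.re (q.1 (A q.2)) ≤ ε) {t : ℝ} (ht : 0 ≤ t)
    (htε : t * ε < 1) (htA : t * ‖A‖ < 1) :
    ∃ R : X →L[𝕜] X, R = 1 + (t : 𝕜) • (A * R) ∧ ‖R‖ ≤ (1 - t * ε)⁻¹ := by
  have hlt : ‖(t : 𝕜) • A‖ < 1 := by
    rwa [norm_smul, RCLike.norm_ofReal, abs_of_nonneg ht]
  obtain ⟨W, hW⟩ := isUnit_one_sub_of_norm_lt_one hlt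
  have hWR : (1 - (t : 𝕜) • A) * (↑W⁻¹ : X →L[𝕜] X) = 1 := by rw [← hW, Units.mul_inv]
  have hpos : 0 < 1 - t * ε := by linarith
  refine ⟨↑W⁻¹, ?_, ?_⟩
  · rw [sub_mul, one_mul, smul_mul_assoc] at hWR
    exact sub_eq_iff_eq_add.mp hWR
  · refine ContinuousLinearMap.opNorm_le_bound _ (inv_nonneg.mpr hpos.le) fun x => ?_
    rw [← div_eq_inv_mul, le_div_iff₀ hpos, mul_comm]
    refine (le_norm_sub_smul hA ht _).trans (le_of_eq ?_)
    have : ((1 - (t : 𝕜) • A) * (↑W⁻¹ : X →L[𝕜] X)) x = x := by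
      rw [hWR, one_apply_eq_self]
    rw [mul_apply_eq_comp] at this
    exact congrArg norm this

/-- The rank one operator `h ⊗ x`, that is, `y ↦ h y • x`. -/
def rankOne (h : StrongDual 𝕜 X) (x : X) : X →L[𝕜] X := h.smulRight x

theorem rankOne_apply (h : StrongDual 𝕜 X) (x y : X) : rankOne h x y = h y • x := rfl

theorem norm_rankOne (h : StrongDual 𝕜 X) (x : X) : ‖rankOne h x‖ = ‖h‖ * ‖x‖ :=
  ContinuousLinearMap.norm_smulRight_apply h x

theorem isCompactOperator_rankOne (h : StrongDual 𝕜 X) (x : X) :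
    IsCompactOperator (rankOne h x) := by
  have : IsCompactOperator (h : X → 𝕜) := isCompactOperator_of_locallyCompactSpace_dom h
  exact this.clm_comp (ContinuousLinearMap.toSpanSingleton 𝕜 x)

theorem adjointOp_rankOne (h : StrongDual 𝕜 X) (x : X) (f : StrongDual 𝕜 X) :
    adjointOp (rankOne h x) f = f x • h := by
  ext y
  rw [adjointOp_apply, rankOne_apply, map_smul, smul_apply, smul_eq_mul,
    smul_eq_mul, mul_comm]

theorem re_apply_adjointOp_le (T : X →L[𝕜] X) {t η : ℝ} (ht : 0 < t)
    (htv : t * numRadius T < 1) {z : StrongDual 𝕜 (StrongDual 𝕜 X)} {f : StrongDual 𝕜 X}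
    (hz : ‖z‖ ≤ 1) (hf : ‖f‖ ≤ 1) (hzf : 1 - η ≤ RCLike.re (z f)) :
    RCLike.re (z (adjointOp T f)) ≤
      (numRadius T + t * ‖T‖ ^ 2) / (1 - t * numRadius T) + η / t := by
  have hpos : 0 < 1 - t * numRadius T := by linarith
  have h1 := norm_one_add_smul_le T ht.le htv
  have h2 : z (f.comp ((1 : X →L[𝕜] X) + (t : 𝕜) • T)) = z f + t * z (adjointOp T f) := by
    change z (adjointOp _ f) = _
    rw [adjointOp_add, adjointOp_one, adjointOp_smul, map_add, map_smul, smul_eq_mul]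
  have h3 : RCLike.re (z f) + t * RCLike.re (z (adjointOp T f)) ≤
      (1 + t ^ 2 * ‖T‖ ^ 2) / (1 - t * numRadius T) := by
    calc _ = RCLike.re (z (f.comp ((1 : X →L[𝕜] X) + (t : 𝕜) • T))) := by
          rw [h2, map_add, RCLike.re_ofReal_mul]
      _ ≤ ‖z (f.comp ((1 : X →L[𝕜] X) + (t : 𝕜) • T))‖ := RCLike.re_le_norm _
      _ ≤ ‖z‖ * ‖f.comp ((1 : X →L[𝕜] X) + (t : 𝕜) • T)‖ := z.le_opNorm _
      _ ≤ 1 * (1 * ‖(1 : X →L[𝕜] X) + (t : 𝕜) • T‖) := by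
          gcongr
          exact (ContinuousLinearMap.opNorm_comp_le _ _).trans (by gcongr)
      _ ≤ _ := by rw [one_mul, one_mul]; exact h1
  have h4 : (1 + t ^ 2 * ‖T‖ ^ 2) / (1 - t * numRadius T) - 1 =
      t * ((numRadius T + t * ‖T‖ ^ 2) / (1 - t * numRadius T)) := by field_simp; ring
  have h5 : t * RCLike.re (z (adjointOp T f)) ≤
      t * ((numRadius T + t * ‖T‖ ^ 2) / (1 - t * numRadius T) + η / t) := by
    rw [mul_add, mul_div_cancel₀ _ ht.ne', ← h4]; linarith
  exact le_of_mul_le_mul_left h5 ht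

/-- Almost aligned pairs `z ∈ X**`, `f ∈ X*` almost satisfy the bound of the numerical radius. The
proof expands `z ((1 + t T)* f)` to first order in `t`. -/
theorem norm_apply_adjointOp_le (T : X →L[𝕜] X) {t η : ℝ} (ht : 0 < t)
    (htv : t * numRadius T < 1) {z : StrongDual 𝕜 (StrongDual 𝕜 X)} {f : StrongDual 𝕜 X}
    (hz : ‖z‖ ≤ 1) (hf : ‖f‖ ≤ 1) (hzf : 1 - η ≤ RCLike.re (z f)) :
    ‖z (adjointOp T f)‖ ≤
      (numRadius T + t * ‖T‖ ^ 2) / (1 - t * numRadius T) + η / t := by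
  obtain ⟨c, hc, hcz⟩ := RCLike.exists_norm_eq_mul_self (z (adjointOp T f))
  have h1 : numRadius (c • T) = numRadius T := by rw [numRadius_smul, hc, one_mul]
  have h2 : ‖c • T‖ = ‖T‖ := by rw [norm_smul, hc, one_mul]
  have h := re_apply_adjointOp_le (c • T) ht (h1 ▸ htv) hz hf hzf
  rw [h1, h2, adjointOp_smul, map_smul, smul_eq_mul, ← hcz, RCLike.ofReal_re] at h
  exact h

theorem norm_apply_adjointOp_le_numRadius (T : X →L[𝕜] X)
    {z : StrongDual 𝕜 (StrongDual 𝕜 X)} {f : StrongDual 𝕜 X}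
    (hz : ‖z‖ ≤ 1) (hf : ‖f‖ ≤ 1) (hzf : z f = 1) : ‖z (adjointOp T f)‖ ≤ numRadius T := by
  have hlim : Filter.Tendsto
      (fun t : ℝ => (numRadius T + t * ‖T‖ ^ 2) / (1 - t * numRadius T)) (nhdsWithin 0 (Set.Ioi 0))
      (nhds ((numRadius T + 0 * ‖T‖ ^ 2) / (1 - 0 * numRadius T))) := by
    have : ContinuousAt (fun t : ℝ => (numRadius T + t * ‖T‖ ^ 2) / (1 - t * numRadius T)) 0 := by
      refine ContinuousAt.div (by fun_prop) (by fun_prop) (by simp)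
    exact this.tendsto.mono_left nhdsWithin_le_nhds
  have hlt : ∀ᶠ t : ℝ in nhdsWithin 0 (Set.Ioi 0), t * numRadius T < 1 := by
    have : ContinuousAt (fun t : ℝ => t * numRadius T) 0 := by fun_prop
    exact (this.eventually_lt continuousAt_const (by simp)).filter_mono nhdsWithin_le_nhds
  have h := ge_of_tendsto hlim (b := ‖z (adjointOp T f)‖) ?_
  · simpa using h
  filter_upwards [hlt, self_mem_nhdsWithin] with t ht1 ht0
  have := norm_apply_adjointOp_le T (η := 0) ht0 ht1 hz hf (by simp [hzf])
  simpa using this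

theorem numRadius_adjointOp (T : X →L[𝕜] X) : numRadius (adjointOp T) = numRadius T := by
  apply le_antisymm
  · exact numRadius_le (numRadius_nonneg _) fun q hq =>
      norm_apply_adjointOp_le_numRadius T hq.1.le hq.2.1.le hq.2.2
  · refine numRadius_le (numRadius_nonneg _) fun q hq => ?_
    have hq' : (NormedSpace.inclusionInDoubleDual 𝕜 X q.2, q.1) ∈
        statePairs 𝕜 (StrongDual 𝕜 X) := by
      refine ⟨?_, hq.1, hq.2.2⟩
      rw [← hq.2.1]
      exact (NormedSpace.inclusionInDoubleDualLi 𝕜 (E := X)).norm_map q.2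
    exact le_numRadius hq' (adjointOp T)

end Operators

/-! ### The defect operator on the bidual -/

theorem norm_le_norm_add_smul_of_unit {V : Type*} [NormedAddCommGroup V] [NormedSpace ℝ V]
    (D : V →L[ℝ] V) (a : ℝ) (h : ∀ z, ‖z‖ = 1 → 1 ≤ ‖z + a • D z‖) (z : V) :
    ‖z‖ ≤ ‖z + a • D z‖ := by
  rcases eq_or_ne z 0 with rfl | hz
  · simp
  have hz0 : 0 < ‖z‖ := norm_pos_iff.mpr hz
  have hc : ‖‖z‖⁻¹‖ = ‖z‖⁻¹ := by rw [norm_inv, norm_norm]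
  have h1 := h (‖z‖⁻¹ • z) (by rw [norm_smul, hc, inv_mul_cancel₀ hz0.ne'])
  rwa [map_smul, smul_comm a, ← smul_add, norm_smul, hc, inv_mul_eq_div, le_div_iff₀ hz0,
    one_mul] at h1

section Defect

variable {𝕜 X : Type*} [RCLike 𝕜] [NormedAddCommGroup X] [NormedSpace 𝕜 X]

/-- The functional `z ⊗ f : T ↦ z (T* f)` on `L_v(X)`, for `z ∈ X**` and `f ∈ X*`. Its continuity
for the numerical radius needs `n(X) > 0`. -/
def dualTensor (hn : 0 < numIndex 𝕜 X) (z : StrongDual 𝕜 (StrongDual 𝕜 X))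
    (f : StrongDual 𝕜 X) : StrongDual 𝕜 (OpV 𝕜 X) :=
  LinearMap.mkContinuous
    { toFun := fun T => z (adjointOp (toOp 𝕜 X T) f)
      map_add' := fun S T => by
        rw [← map_add]; congr 1; ext y; simp [adjointOp_apply]
      map_smul' := fun c T => by
        rw [RingHom.id_apply, ← map_smul]; congr 1; ext y; simp [adjointOp_apply] }
    (‖z‖ * ‖f‖ * (numIndex 𝕜 X)⁻¹) fun T => by
      have h1 : ‖toOp 𝕜 X T‖ ≤ (numIndex 𝕜 X)⁻¹ * ‖T‖ := by
        rw [inv_mul_eq_div, le_div_iff₀ hn, mul_comm]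
        exact numIndex_mul_norm_le _
      calc ‖z (f.comp (toOp 𝕜 X T))‖ ≤ ‖z‖ * (‖f‖ * ‖toOp 𝕜 X T‖) :=
            z.le_opNorm_of_le (ContinuousLinearMap.opNorm_comp_le _ _)
        _ ≤ ‖z‖ * (‖f‖ * ((numIndex 𝕜 X)⁻¹ * ‖T‖)) := by gcongr
        _ = _ := by ring

theorem dualTensor_apply (hn : 0 < numIndex 𝕜 X) (z : StrongDual 𝕜 (StrongDual 𝕜 X))
    (f : StrongDual 𝕜 X) (T : OpV 𝕜 X) :
    dualTensor hn z f T = z (adjointOp (toOp 𝕜 X T) f) := rfl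

theorem norm_dualTensor_le (hn : 0 < numIndex 𝕜 X) (z : StrongDual 𝕜 (StrongDual 𝕜 X))
    (f : StrongDual 𝕜 X) : ‖dualTensor hn z f‖ ≤ ‖z‖ * ‖f‖ * (numIndex 𝕜 X)⁻¹ :=
  LinearMap.mkContinuous_norm_le _ (by positivity) _

variable (𝕜 X) in
/-- The identity operator as an element of `L_v(X)`. -/
def idV : OpV 𝕜 X := (toOp 𝕜 X).symm 1

theorem toOp_idV : toOp 𝕜 X (idV 𝕜 X) = 1 := rfl

theorem norm_idV_le : ‖idV 𝕜 X‖ ≤ 1 :=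
  (numRadius_le_norm _).trans ContinuousLinearMap.norm_id_le

theorem dualTensor_idV (hn : 0 < numIndex 𝕜 X) (z : StrongDual 𝕜 (StrongDual 𝕜 X))
    (f : StrongDual 𝕜 X) : dualTensor hn z f (idV 𝕜 X) = z f := rfl

/-- The operator on `X**` with `(defect z) f = P (z ⊗ f) (1)`. It measures how far the functionals
`z ⊗ f` are from lying in the kernel of `P`, as seen by the identity. -/
def defect (hn : 0 < numIndex 𝕜 X)
    (P : StrongDual 𝕜 (OpV 𝕜 X) →L[𝕜] StrongDual 𝕜 (OpV 𝕜 X)) :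
    StrongDual 𝕜 (StrongDual 𝕜 X) →L[𝕜] StrongDual 𝕜 (StrongDual 𝕜 X) :=
  LinearMap.mkContinuous₂
    (LinearMap.mk₂ 𝕜 (fun z f => P (dualTensor hn z f) (idV 𝕜 X))
      (fun z z' f => by
        have : dualTensor hn (z + z') f = dualTensor hn z f + dualTensor hn z' f := by
          ext T; simp [dualTensor_apply]
        rw [this, map_add]; rfl)
      (fun c z f => by
        have : dualTensor hn (c • z) f = c • dualTensor hn z f := by
          ext T; simp [dualTensor_apply]
        rw [this, map_smul]; rfl)
      (fun z f f' => by
        have : dualTensor hn z (f + f') = dualTensor hn z f + dualTensor hn z f' := by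
          ext T; simp [dualTensor_apply]
        rw [this, map_add]; rfl)
      (fun c z f => by
        have : dualTensor hn z (c • f) = c • dualTensor hn z f := by
          ext T; simp [dualTensor_apply]
        rw [this, map_smul]; rfl))
    (‖P‖ * (numIndex 𝕜 X)⁻¹) fun z f => by
      calc ‖P (dualTensor hn z f) (idV 𝕜 X)‖ ≤ ‖P (dualTensor hn z f)‖ * ‖idV 𝕜 X‖ :=
            ContinuousLinearMap.le_opNorm _ _
        _ ≤ (‖P‖ * (‖z‖ * ‖f‖ * (numIndex 𝕜 X)⁻¹)) * 1 := by
            gcongr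
            · exact P.le_opNorm_of_le (norm_dualTensor_le hn z f)
            · exact norm_idV_le
        _ = _ := by ring

variable {hn : 0 < numIndex 𝕜 X} {P : StrongDual 𝕜 (OpV 𝕜 X) →L[𝕜] StrongDual 𝕜 (OpV 𝕜 X)}

theorem defect_apply (z : StrongDual 𝕜 (StrongDual 𝕜 X)) (f : StrongDual 𝕜 X) :
    defect hn P z f = P (dualTensor hn z f) (idV 𝕜 X) := rfl

/-- The real parts of `z g * f x`, over the unit balls, have supremum `‖z‖ ‖f‖`. -/
theorem mul_norm_le_of_forall {z : StrongDual 𝕜 (StrongDual 𝕜 X)} {f : StrongDual 𝕜 X} {R : ℝ}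
    (h : ∀ (g : StrongDual 𝕜 X) (x : X), ‖g‖ ≤ 1 → ‖x‖ ≤ 1 → RCLike.re (z g * f x) ≤ R) :
    ‖z‖ * ‖f‖ ≤ R := by
  have h1 : ∀ (g : StrongDual 𝕜 X) (x : X), ‖g‖ ≤ 1 → ‖x‖ ≤ 1 → ‖z g‖ * ‖f x‖ ≤ R := by
    intro g x hg hx
    obtain ⟨c, hc, hcz⟩ := RCLike.exists_norm_eq_mul_self (z g * f x)
    have := h (c • g) x (by rwa [norm_smul, hc, one_mul]) hx
    rw [map_smul, smul_eq_mul, mul_assoc, ← hcz, RCLike.ofReal_re, norm_mul] at this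
    exact this
  have h2 : ∀ x : X, ‖x‖ ≤ 1 → ‖z‖ * ‖f x‖ ≤ R := by
    intro x hx
    have := ContinuousLinearMap.opNorm_bound_of_ball_bound one_pos R (f x • z) fun g hg => by
      rw [smul_apply, norm_smul, mul_comm]
      exact h1 g x (by simpa using hg) hx
    rwa [norm_smul, div_one, mul_comm] at this
  have := ContinuousLinearMap.opNorm_bound_of_ball_bound one_pos R ((‖z‖ : 𝕜) • f) fun x hx => by
    rw [smul_apply, norm_smul, RCLike.norm_ofReal, abs_of_nonneg z.opNorm_nonneg]
    exact h2 x (by simpa using hx)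
  rwa [norm_smul, RCLike.norm_ofReal, abs_of_nonneg z.opNorm_nonneg, div_one] at this

/-- The component of `z ⊗ f` in the kernel of `P` agrees with `z ⊗ f` on rank one operators, which
already forces its norm to be at least `‖z‖ ‖f‖`. -/
theorem norm_mul_norm_le_norm_sub (hP : IsLProjection (compactV 𝕜 X) P)
    (z : StrongDual 𝕜 (StrongDual 𝕜 X)) (f : StrongDual 𝕜 X) :
    ‖z‖ * ‖f‖ ≤ ‖dualTensor hn z f - P (dualTensor hn z f)‖ := by
  refine mul_norm_le_of_forall fun g x hg hx => ?_
  let L : OpV 𝕜 X := (toOp 𝕜 X).symm (rankOne g x)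
  have hL : L ∈ compactV 𝕜 X := isCompactOperator_rankOne g x
  have hL1 : ‖L‖ ≤ 1 := by
    refine (numRadius_le_norm (rankOne g x)).trans ?_
    rw [norm_rankOne]
    exact mul_le_one₀ hg (norm_nonneg _) hx
  have e : (dualTensor hn z f - P (dualTensor hn z f)) L = z g * f x := by
    rw [sub_apply, hP.apply_eq_zero _ hL, sub_zero]
    change z (adjointOp (rankOne g x) f) = _
    rw [adjointOp_rankOne, map_smul, smul_eq_mul, mul_comm]
  rw [← e]
  exact (RCLike.re_le_norm _).trans ((ContinuousLinearMap.le_opNorm _ _).trans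
    (mul_le_of_le_one_right (norm_nonneg _) hL1))

/-- For almost aligned `z` and `f` in the unit balls, `z ⊗ f` has norm almost at most one. -/
theorem exists_norm_dualTensor_le (hn : 0 < numIndex 𝕜 X) {η : ℝ} (hη : 0 < η) :
    ∃ κ > 0, κ ≤ η ∧ ∀ (z : StrongDual 𝕜 (StrongDual 𝕜 X)) (f : StrongDual 𝕜 X),
      ‖z‖ ≤ 1 → ‖f‖ ≤ 1 → 1 - κ ≤ RCLike.re (z f) → ‖dualTensor hn z f‖ ≤ 1 + η := by
  obtain ⟨C, hC⟩ : ∃ C, C = (numIndex 𝕜 X)⁻¹ := ⟨_, rfl⟩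
  have hC0 : 0 < C := by rw [hC]; positivity
  -- `s` solves `1 + s C ^ 2 = (1 + η / 2) (1 - s)`
  obtain ⟨s, hs⟩ : ∃ s, s = (η / 2) / (C ^ 2 + 1 + η / 2) := ⟨_, rfl⟩
  have hden : 0 < C ^ 2 + 1 + η / 2 := by positivity
  have hs0 : 0 < s := by rw [hs]; positivity
  have hsm : s * (C ^ 2 + 1 + η / 2) = η / 2 := by rw [hs]; field_simp
  have hs1 : s < 1 := by
    rw [hs, div_lt_one hden]; nlinarith [sq_nonneg C]
  refine ⟨min η (s * (η / 2)), lt_min hη (by positivity), min_le_left _ _, ?_⟩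
  intro z f hz hf hzf
  refine ContinuousLinearMap.opNorm_le_bound _ (by positivity) fun T => ?_
  have hv0 : 0 ≤ ‖T‖ := norm_nonneg _
  have hTC : ‖toOp 𝕜 X T‖ ≤ C * ‖T‖ := by
    rw [hC, inv_mul_eq_div, le_div_iff₀ hn, mul_comm]
    exact numIndex_mul_norm_le _
  rcases hv0.eq_or_lt with hv | hv
  · have : toOp 𝕜 X T = 0 := by
      rw [← hv, mul_zero] at hTC
      exact norm_le_zero_iff.mp hTC
    have h0 : dualTensor hn z f T = 0 := by
      rw [dualTensor_apply, this]
      have : adjointOp (0 : X →L[𝕜] X) f = 0 := by ext; simp [adjointOp_apply]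
      rw [this, map_zero]
    rw [h0, norm_zero]
    positivity
  · have hvT : numRadius (toOp 𝕜 X T) = ‖T‖ := rfl
    have hsv : s / ‖T‖ * ‖T‖ = s := div_mul_cancel₀ _ hv.ne'
    have h := norm_apply_adjointOp_le (toOp 𝕜 X T) (t := s / ‖T‖)
      (η := min η (s * (η / 2))) (by positivity) (by rw [hvT, hsv]; exact hs1) hz hf hzf
    rw [hvT, hsv] at h
    have h1 : (‖T‖ + s / ‖T‖ * ‖toOp 𝕜 X T‖ ^ 2) / (1 - s) ≤ (1 + η / 2) * ‖T‖ := by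
      rw [div_le_iff₀ (by linarith)]
      have : s / ‖T‖ * ‖toOp 𝕜 X T‖ ^ 2 ≤ s * C ^ 2 * ‖T‖ := by
        calc s / ‖T‖ * ‖toOp 𝕜 X T‖ ^ 2 ≤ s / ‖T‖ * (C * ‖T‖) ^ 2 := by gcongr
          _ = _ := by field_simp
      have h3 : 1 + s * C ^ 2 = (1 + η / 2) * (1 - s) := by linarith
      calc _ ≤ (1 + s * C ^ 2) * ‖T‖ := by linarith
        _ = _ := by rw [h3]; ring
    have h2 : min η (s * (η / 2)) / (s / ‖T‖) ≤ η / 2 * ‖T‖ := by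
      rw [div_le_iff₀ (by positivity)]
      calc min η (s * (η / 2)) ≤ s * (η / 2) := min_le_right _ _
        _ = _ := by field_simp
    rw [dualTensor_apply]
    linarith

theorem norm_defect_apply_le (hP : IsLProjection (compactV 𝕜 X) P)
    {z : StrongDual 𝕜 (StrongDual 𝕜 X)} {f : StrongDual 𝕜 X} {η : ℝ}
    (h : ‖dualTensor hn z f‖ ≤ ‖z‖ * ‖f‖ + η) : ‖defect hn P z f‖ ≤ η := by
  have h1 := hP.norm_eq (dualTensor hn z f)
  have h2 := norm_mul_norm_le_norm_sub (hn := hn) hP z f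
  have h3 : ‖defect hn P z f‖ ≤ ‖P (dualTensor hn z f)‖ :=
    ((P (dualTensor hn z f)).le_opNorm _).trans
      (mul_le_of_le_one_right (norm_nonneg _) norm_idV_le)
  linarith

theorem exists_re_apply_ge (z : StrongDual 𝕜 (StrongDual 𝕜 X)) {r : ℝ} (hr : r < ‖z‖) :
    ∃ f : StrongDual 𝕜 X, ‖f‖ ≤ 1 ∧ r ≤ RCLike.re (z f) := by
  by_contra! hcon
  have := ContinuousLinearMap.opNorm_bound_of_ball_bound one_pos r z fun f hf => by
    obtain ⟨c, hc, hcz⟩ := RCLike.exists_norm_eq_mul_self (z f)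
    have := hcon (c • f) (by rw [norm_smul, hc, one_mul]; simpa using hf)
    rw [map_smul, smul_eq_mul, ← hcz, RCLike.ofReal_re] at this
    exact this.le
  rw [div_one] at this
  linarith

/-- If `f` almost norms `z`, then `z ⊗ f` has norm almost `‖z‖ ‖f‖`, all of which is used up by its
component in the kernel of `P`; hence `(defect z) f` is almost zero, for either sign of `a`. -/
theorem one_le_norm_add_smul_defect (hP : IsLProjection (compactV 𝕜 X) P) (a : ℝ)
    {z : StrongDual 𝕜 (StrongDual 𝕜 X)} (hz : ‖z‖ = 1) : 1 ≤ ‖z + a • defect hn P z‖ := by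
  refine le_of_forall_pos_sub_le fun ε hε => ?_
  obtain ⟨η, hη⟩ : ∃ η, η = ε / (1 + 2 * |a|) := ⟨_, rfl⟩
  have hpos : 0 < 1 + 2 * |a| := by positivity
  have hη0 : 0 < η := by rw [hη]; positivity
  have hηε : η * (1 + 2 * |a|) = ε := by rw [hη]; field_simp
  obtain ⟨κ, hκ, hκη, hbound⟩ := exists_norm_dualTensor_le hn hη0
  obtain ⟨f, hf, hzf⟩ := exists_re_apply_ge z (by linarith : 1 - κ < ‖z‖)
  have h1 := hbound z f hz.le hf hzf
  have hf1 : 1 - κ ≤ ‖f‖ := by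
    have := z.le_opNorm f
    rw [hz, one_mul] at this
    exact hzf.trans ((RCLike.re_le_norm _).trans this)
  have h2 : ‖defect hn P z f‖ ≤ 2 * η := norm_defect_apply_le hP (by rw [hz]; linarith)
  have h3 : |RCLike.re (defect hn P z f)| ≤ 2 * η := (RCLike.abs_re_le_norm _).trans h2
  have h4 : |a * RCLike.re (defect hn P z f)| ≤ |a| * (2 * η) := by
    rw [abs_mul]; gcongr
  calc 1 - ε ≤ RCLike.re (z f) + a * RCLike.re (defect hn P z f) := by
        have := (abs_le.mp h4).1
        nlinarith
    _ = RCLike.re ((z + a • defect hn P z) f) := by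
        rw [add_apply, smul_apply, map_add, RCLike.smul_re]
    _ ≤ ‖(z + a • defect hn P z) f‖ := RCLike.re_le_norm _
    _ ≤ ‖z + a • defect hn P z‖ * ‖f‖ := ContinuousLinearMap.le_opNorm _ _
    _ ≤ _ := mul_le_of_le_one_right (ContinuousLinearMap.opNorm_nonneg _) hf

/-- The case of `X**`, for an operator that is linear over `𝕜`. -/
theorem norm_le_norm_add_smul_of_unit_bidual
    (B : StrongDual 𝕜 (StrongDual 𝕜 X) →L[𝕜] StrongDual 𝕜 (StrongDual 𝕜 X)) (a : ℝ)
    (h : ∀ z, ‖z‖ = 1 → 1 ≤ ‖z + a • B z‖) (z : StrongDual 𝕜 (StrongDual 𝕜 X)) :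
    ‖z‖ ≤ ‖z + a • B z‖ := by
  have h1 := @norm_le_norm_add_smul_of_unit (StrongDual 𝕜 (StrongDual 𝕜 X)) _ _
    (B.restrictScalars ℝ) a
  have h2 := h1 h
  exact h2 z

theorem norm_le_norm_add_smul_defect (hP : IsLProjection (compactV 𝕜 X) P) (a : ℝ)
    (z : StrongDual 𝕜 (StrongDual 𝕜 X)) : ‖z‖ ≤ ‖z + a • defect hn P z‖ := by
  have h1 := @norm_le_norm_add_smul_of_unit_bidual 𝕜 X _ _ _ (defect hn P) a
  have h2 := h1 fun w hw => one_le_norm_add_smul_defect hP a hw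
  exact h2 z

end Defect

/-! ### Alignment by compact perturbations of the identity -/

section Alignment

variable {𝕜 X : Type*} [RCLike 𝕜] [NormedAddCommGroup X] [NormedSpace 𝕜 X]
  {hn : 0 < numIndex 𝕜 X} {P : StrongDual 𝕜 (OpV 𝕜 X) →L[𝕜] StrongDual 𝕜 (OpV 𝕜 X)}

theorem norm_apply_adjointOp_le_mul (z : StrongDual 𝕜 (StrongDual 𝕜 X)) (S : X →L[𝕜] X)
    (f : StrongDual 𝕜 X) : ‖z (adjointOp S f)‖ ≤ ‖z‖ * (‖f‖ * ‖S‖) :=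
  z.le_opNorm_of_le (ContinuousLinearMap.opNorm_comp_le f S)

theorem isCompactOperator_mul_sub_one {S T : X →L[𝕜] X}
    (hS : IsCompactOperator (S - 1 : X →L[𝕜] X)) (hT : IsCompactOperator (T - 1 : X →L[𝕜] X)) :
    IsCompactOperator (S * T - 1 : X →L[𝕜] X) := by
  have e : S * T - 1 = (S - 1) * T + (T - 1) := by
    rw [sub_mul, one_mul]; abel
  rw [e]
  exact (hS.comp_clm T).add hT

/-- First-order variation of `z f` under compact perturbations of the identity: for a rank one
contraction `L = g ⊗ x` and the operator `K` of `IsLProjection.exists_mem_norm_le`, the numerical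
range of `A = L - K` has real part at most `ε`, so that `(1 - t A)⁻¹` has norm at most
`1 + ε`; here `z (K* f)` is almost `z f - (defect z) f`. -/
theorem exists_perturbation [CompleteSpace X] (hP : IsLProjection (compactV 𝕜 X) P)
    (z : StrongDual 𝕜 (StrongDual 𝕜 X)) (f g : StrongDual 𝕜 X) (x : X) (hg : ‖g‖ ≤ 1)
    (hx : ‖x‖ ≤ 1) {t ε : ℝ} (ht : 0 < t)
    (htC : t * (2 * (numIndex 𝕜 X)⁻¹ + 1) ≤ 1 / 2) (hε : 0 < ε) (hε1 : ε ≤ 1) :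
    ∃ S : X →L[𝕜] X, IsCompactOperator (S - 1 : X →L[𝕜] X) ∧ ‖S‖ ≤ 1 + ε ∧
      RCLike.re (z f) + t * (RCLike.re (z g * f x) - RCLike.re (z f)
        + RCLike.re (defect hn P z f) - ε)
        - 2 * t ^ 2 * (2 * (numIndex 𝕜 X)⁻¹ + 1) ^ 2 * (‖z‖ * ‖f‖) ≤
        RCLike.re (z (adjointOp S f)) := by
  obtain ⟨C, hC⟩ : ∃ C, C = 2 * (numIndex 𝕜 X)⁻¹ + 1 := ⟨_, rfl⟩
  have hn0 : 0 < (numIndex 𝕜 X)⁻¹ := inv_pos.mpr hn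
  rw [← hC] at htC ⊢
  have hC1 : 1 ≤ C := by rw [hC]; linarith
  let L : OpV 𝕜 X := (toOp 𝕜 X).symm (rankOne g x)
  have hL : L ∈ compactV 𝕜 X := isCompactOperator_rankOne g x
  have hL1 : ‖L‖ ≤ 1 := by
    refine (numRadius_le_norm (rankOne g x)).trans ?_
    rw [norm_rankOne]
    exact mul_le_one₀ hg (norm_nonneg _) hx
  obtain ⟨φ, hφdef⟩ : ∃ φ, φ = dualTensor hn z f - P (dualTensor hn z f) := ⟨_, rfl⟩
  have hφ : P φ = 0 := by
    rw [hφdef, map_sub, hP.idem]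
    ext T
    exact sub_self _
  obtain ⟨K, hK, hK1, hK2⟩ := hP.exists_mem_norm_le hL hL1 (norm_idV_le (𝕜 := 𝕜) (X := X)) hφ hε
  let K' : X →L[𝕜] X := toOp 𝕜 X K
  let A : X →L[𝕜] X := rankOne g x - K'
  have hA1 : numRadius (A + 1) ≤ 1 + ε := by
    have e : A + 1 = toOp 𝕜 X (L + idV 𝕜 X - K) := by
      change rankOne g x - K' + 1 = rankOne g x + 1 - K'
      abel
    rw [e]
    exact hK1
  have hAre : ∀ q ∈ statePairs 𝕜 X, RCLike.re (q.1 (A q.2)) ≤ ε := by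
    intro q hq
    have h1 := (re_apply_le_numRadius (A + 1) q hq).trans hA1
    rw [add_apply, one_apply_eq_self, map_add, hq.2.2, map_add, RCLike.one_re] at h1
    linarith
  have hAn : ‖A‖ ≤ C := by
    have h1 : ‖A + 1‖ ≤ 2 * (numIndex 𝕜 X)⁻¹ := by
      have := numIndex_mul_norm_le (A + 1)
      rw [← div_eq_mul_inv, le_div_iff₀ hn]
      linarith
    have h2 : ‖A‖ ≤ ‖A + 1‖ + ‖(1 : X →L[𝕜] X)‖ := by
      have := norm_sub_le (A + 1) 1
      rwa [add_sub_cancel_right] at this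
    have h3 : ‖(1 : X →L[𝕜] X)‖ ≤ 1 := ContinuousLinearMap.norm_id_le
    rw [hC]
    linarith
  have htA : t * ‖A‖ ≤ 1 / 2 := (mul_le_mul_of_nonneg_left hAn ht.le).trans htC
  have ht1 : t ≤ 1 / 2 := by nlinarith
  have htε : t * ε ≤ ε / 2 := by nlinarith
  obtain ⟨R, hR, hRn⟩ := exists_resolvent hAre ht.le (by linarith) (by linarith)
  have hpos : 0 < 1 - t * ε := by linarith
  have hR1 : ‖R‖ ≤ 1 + ε := by
    refine hRn.trans ?_
    rw [inv_le_iff_one_le_mul₀ hpos]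
    nlinarith
  refine ⟨R, ?_, hR1, ?_⟩
  · have e : R - 1 = (t : 𝕜) • (A * R) := by
      rw [sub_eq_iff_eq_add, add_comm]; exact hR
    rw [e]
    exact (((isCompactOperator_rankOne g x).sub hK).comp_clm R).smul (t : 𝕜)
  have hR2 : R = 1 + (t : 𝕜) • A + ((t : 𝕜) * t) • (A * A * R) := by
    calc R = 1 + (t : 𝕜) • (A * R) := hR
      _ = 1 + (t : 𝕜) • (A * (1 + (t : 𝕜) • (A * R))) :=
          congrArg (fun Q : X →L[𝕜] X => 1 + (t : 𝕜) • (A * Q)) hR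
      _ = _ := by
        rw [mul_add, mul_one, smul_add, mul_smul_comm, smul_smul, ← mul_assoc, add_assoc]
  have hz : z (adjointOp R f) = z f + t * z (adjointOp A f)
      + (t * t) * z (adjointOp (A * A * R) f) := by
    conv_lhs => rw [hR2]
    rw [adjointOp_add, adjointOp_add, adjointOp_one, adjointOp_smul, adjointOp_smul, map_add,
      map_add, map_smul, map_smul, smul_eq_mul, smul_eq_mul]
  have hrem : ‖z (adjointOp (A * A * R) f)‖ ≤ 2 * C ^ 2 * (‖z‖ * ‖f‖) := by
    have h1 : ‖A * A * R‖ ≤ C * C * 2 :=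
      (norm_mul_le _ _).trans (mul_le_mul ((norm_mul_le _ _).trans
        (mul_le_mul hAn hAn (norm_nonneg _) (by linarith))) (by linarith) (norm_nonneg _)
        (by positivity))
    calc _ ≤ ‖z‖ * (‖f‖ * ‖A * A * R‖) := norm_apply_adjointOp_le_mul _ _ _
      _ ≤ ‖z‖ * (‖f‖ * (C * C * 2)) :=
          mul_le_mul_of_nonneg_left (mul_le_mul_of_nonneg_left h1 f.opNorm_nonneg)
            z.opNorm_nonneg
      _ = _ := by ring
  -- on compact operators the functional agrees with its component in the kernel of `P`
  have hzK : z (adjointOp K' f) = φ K := by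
    rw [hφdef, sub_apply, hP.apply_eq_zero _ hK, sub_zero]; rfl
  have hzA : z (adjointOp A f) = z g * f x - (z f - defect hn P z f) + φ (idV 𝕜 X - K) := by
    have h1 : φ (idV 𝕜 X) = z f - defect hn P z f := by
      rw [hφdef, sub_apply, dualTensor_idV, defect_apply]
    have h2 : z (adjointOp A f) = z (adjointOp (rankOne g x) f) - z (adjointOp K' f) := by
      rw [← map_sub, ← adjointOp_sub]
    rw [h2, adjointOp_rankOne, map_smul, smul_eq_mul, hzK, map_sub φ, h1]
    ring
  have hreA : RCLike.re (z g * f x) - RCLike.re (z f) + RCLike.re (defect hn P z f) - ε ≤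
      RCLike.re (z (adjointOp A f)) := by
    have := (abs_le.mp ((RCLike.abs_re_le_norm (φ (idV 𝕜 X - K))).trans hK2)).1
    rw [hzA, map_add, map_sub, map_sub]
    linarith
  have hre2 := (abs_le.mp ((RCLike.abs_re_le_norm _).trans hrem)).1
  have hzre : RCLike.re (z (adjointOp R f)) = RCLike.re (z f) + t * RCLike.re (z (adjointOp A f))
      + t ^ 2 * RCLike.re (z (adjointOp (A * A * R) f)) := by
    rw [hz, map_add, map_add, ← RCLike.ofReal_mul, RCLike.re_ofReal_mul, RCLike.re_ofReal_mul, sq]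
  rw [hzre]
  have h1 := mul_le_mul_of_nonneg_left hreA ht.le
  have h2 := mul_le_mul_of_nonneg_left hre2 (sq_nonneg t)
  linarith

/-- If `Re (z f)` is almost maximal under compact perturbations of the identity of norm almost one,
then the first-order variation in `exists_perturbation` is almost nonpositive. -/
theorem norm_mul_norm_le_of_maximal [CompleteSpace X] (hP : IsLProjection (compactV 𝕜 X) P)
    (z : StrongDual 𝕜 (StrongDual 𝕜 X)) (f : StrongDual 𝕜 X) {t ε η : ℝ} (ht : 0 < t)
    (htC : t * (2 * (numIndex 𝕜 X)⁻¹ + 1) ≤ 1 / 2) (hε : 0 < ε)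
    (hmax : ∀ S : X →L[𝕜] X, IsCompactOperator (S - 1 : X →L[𝕜] X) → ‖S‖ ≤ 1 + ε →
      RCLike.re (z (adjointOp S f)) ≤ RCLike.re (z f) + η) :
    ‖z‖ * ‖f‖ ≤ RCLike.re (z f) - RCLike.re (defect hn P z f) + η / t
      + 2 * t * (2 * (numIndex 𝕜 X)⁻¹ + 1) ^ 2 * (‖z‖ * ‖f‖) := by
  refine mul_norm_le_of_forall fun g x hg hx => ?_
  refine le_of_forall_pos_le_add fun δ hδ => ?_
  obtain ⟨ε', hε'⟩ : ∃ ε', ε' = min δ (min ε 1) := ⟨_, rfl⟩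
  have hε'0 : 0 < ε' := by rw [hε']; exact lt_min hδ (lt_min hε one_pos)
  have hε'δ : ε' ≤ δ := by rw [hε']; exact min_le_left _ _
  have hε'ε : ε' ≤ ε := by rw [hε']; exact (min_le_right _ _).trans (min_le_left _ _)
  have hε'1 : ε' ≤ 1 := by rw [hε']; exact (min_le_right _ _).trans (min_le_right _ _)
  obtain ⟨S, hS1, hS2, hS3⟩ := exists_perturbation (hn := hn) hP z f g x hg hx ht htC hε'0 hε'1
  have h := hS3.trans (hmax S hS1 (by linarith))
  have h2 : t * (RCLike.re (z g * f x)) ≤ t * (RCLike.re (z f) - RCLike.re (defect hn P z f)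
      + η / t + 2 * t * (2 * (numIndex 𝕜 X)⁻¹ + 1) ^ 2 * (‖z‖ * ‖f‖) + ε') := by
    have : t * (η / t) = η := mul_div_cancel₀ _ ht.ne'
    linarith
  have h3 := le_of_mul_le_mul_left h2 ht
  linarith

/-- The real numbers `r` such that, for every `ε > 0`, some compact perturbation `S` of the identity
with `‖S‖ ≤ 1 + ε` satisfies `r ≤ Re (z (S* f))`. -/
def reach (f : StrongDual 𝕜 X) (z : StrongDual 𝕜 (StrongDual 𝕜 X)) : Set ℝ :=
  {r | ∀ ε > 0, ∃ S : X →L[𝕜] X, IsCompactOperator (S - 1 : X →L[𝕜] X) ∧ ‖S‖ ≤ 1 + ε ∧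
    r ≤ RCLike.re (z (adjointOp S f))}

theorem re_apply_mem_reach (f : StrongDual 𝕜 X) (z : StrongDual 𝕜 (StrongDual 𝕜 X)) :
    RCLike.re (z f) ∈ reach f z := fun ε hε =>
  ⟨1, by rw [sub_self]; exact isCompactOperator_zero,
    ContinuousLinearMap.norm_id_le.trans (by linarith), le_rfl⟩

theorem reach_mono {f : StrongDual 𝕜 X} {z : StrongDual 𝕜 (StrongDual 𝕜 X)} {r s : ℝ}
    (hr : r ∈ reach f z) (hs : s ≤ r) : s ∈ reach f z := fun ε hε => by
  obtain ⟨S, h1, h2, h3⟩ := hr ε hε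
  exact ⟨S, h1, h2, hs.trans h3⟩

theorem bddAbove_reach (f : StrongDual 𝕜 X) (z : StrongDual 𝕜 (StrongDual 𝕜 X)) :
    BddAbove (reach f z) := by
  refine ⟨‖z‖ * (‖f‖ * 2), fun r hr => ?_⟩
  obtain ⟨S, h1, h2, h3⟩ := hr 1 one_pos
  refine h3.trans ((RCLike.re_le_norm _).trans ((norm_apply_adjointOp_le_mul z S f).trans ?_))
  exact mul_le_mul_of_nonneg_left
    (mul_le_mul_of_nonneg_left (by linarith) f.opNorm_nonneg) z.opNorm_nonneg

theorem smul_mem_reach {f : StrongDual 𝕜 X} {z : StrongDual 𝕜 (StrongDual 𝕜 X)} {r c : ℝ}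
    (hc : 0 < c) (hr : r ∈ reach f z) : c * r ∈ reach f (c • z) := fun ε hε => by
  obtain ⟨S, h1, h2, h3⟩ := hr ε hε
  refine ⟨S, h1, h2, ?_⟩
  rw [smul_apply, RCLike.smul_re]
  exact mul_le_mul_of_nonneg_left h3 hc.le

/-- The asymptotic supremum of `Re (z (S* f))` over compact perturbations `S` of the identity with
norm tending to one, truncated at zero: `le_of_transport` asks for a nonnegative function. -/
def reachSup (f : StrongDual 𝕜 X) (z : StrongDual 𝕜 (StrongDual 𝕜 X)) : ℝ :=
  max 0 (sSup (reach f z))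

theorem sSup_reach_smul_le (f : StrongDual 𝕜 X) (z : StrongDual 𝕜 (StrongDual 𝕜 X)) {c : ℝ}
    (hc : 0 < c) : c * sSup (reach f z) ≤ sSup (reach f (c • z)) := by
  rw [mul_comm, ← le_div_iff₀ hc]
  refine csSup_le ⟨_, re_apply_mem_reach f z⟩ fun r hr => ?_
  rw [le_div_iff₀ hc, mul_comm]
  exact le_csSup (bddAbove_reach _ _) (smul_mem_reach hc hr)

theorem reachSup_smul (f : StrongDual 𝕜 X) (z : StrongDual 𝕜 (StrongDual 𝕜 X)) {c : ℝ}
    (hc : 0 < c) : reachSup f (c • z) = c * reachSup f z := by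
  have h1 := sSup_reach_smul_le f z hc
  have h2 := sSup_reach_smul_le f (c • z) (inv_pos.mpr hc)
  have e : c⁻¹ • c • z = z := by
    ext g
    rw [smul_apply, smul_apply, inv_smul_smul₀ hc.ne']
  rw [e, inv_mul_le_iff₀ hc] at h2
  rw [reachSup, reachSup, mul_max_of_nonneg _ _ hc.le, mul_zero, le_antisymm h2 h1]

/-- The hypothesis of `le_of_transport` for `reachSup f`. If `S` almost realises the supremum `s`
for `z`, then `f' = S* f` is almost maximal, so `norm_mul_norm_le_of_maximal` bounds
`Re (w f') ≤ ‖z‖ ‖f'‖` by `Re (z f') - Re ((defect z) f')` up to a small error; thus the same `S`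
gives almost `s` for the moved functional. -/
theorem reachSup_le_transport [CompleteSpace X] (hP : IsLProjection (compactV 𝕜 X) P)
    (f : StrongDual 𝕜 X) (z w : StrongDual 𝕜 (StrongDual 𝕜 X)) {a : ℝ} (ha : 0 ≤ a)
    (hw : ‖w‖ ≤ ‖z‖) :
    reachSup f z ≤ reachSup f (z + a • (z - defect hn P z - w)) := by
  refine max_le (le_max_left _ _) (le_max_of_le_right ?_)
  refine le_of_forall_pos_sub_le fun η hη => ?_
  refine le_csSup (bddAbove_reach _ _) fun ε₁ hε₁ => ?_
  obtain ⟨s, hs⟩ : ∃ s, s = sSup (reach f z) := ⟨_, rfl⟩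
  obtain ⟨C, hC⟩ : ∃ C, C = 2 * (numIndex 𝕜 X)⁻¹ + 1 := ⟨_, rfl⟩
  have hn0 : 0 < (numIndex 𝕜 X)⁻¹ := inv_pos.mpr hn
  have hC0 : 0 < C := by rw [hC]; linarith
  obtain ⟨D, hD⟩ : ∃ D, D = ‖z‖ * (‖f‖ * 2) := ⟨_, rfl⟩
  have hD0 : 0 ≤ D := by
    rw [hD]; exact mul_nonneg z.opNorm_nonneg (mul_nonneg f.opNorm_nonneg (by norm_num))
  -- step size making the second order remainder negligible
  obtain ⟨t, ht0, htC, htD⟩ : ∃ t > 0, t * C ≤ 1 / 2 ∧ a * (2 * t * C ^ 2 * D) ≤ η / 2 := by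
    have hden : 0 < 4 * a * C ^ 2 * D + 1 := by positivity
    refine ⟨min (1 / (2 * C)) (η / (4 * a * C ^ 2 * D + 1)), by positivity, ?_, ?_⟩
    · calc _ ≤ 1 / (2 * C) * C := by gcongr; exact min_le_left _ _
        _ = 1 / 2 := by field_simp
    · calc a * (2 * min (1 / (2 * C)) (η / (4 * a * C ^ 2 * D + 1)) * C ^ 2 * D)
          ≤ a * (2 * (η / (4 * a * C ^ 2 * D + 1)) * C ^ 2 * D) := by
            gcongr; exact min_le_right _ _
        _ = (4 * a * C ^ 2 * D) / (4 * a * C ^ 2 * D + 1) * (η / 2) := by field_simp; ring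
        _ ≤ 1 * (η / 2) := by
            gcongr
            rw [div_le_one hden]; linarith
        _ = η / 2 := one_mul _
  -- the tolerance for maximality; it is divided by the step size `t` below
  obtain ⟨η', hη'⟩ : ∃ η', η' = (η / 2) / (1 + 2 * a / t) := ⟨_, rfl⟩
  have hη'pos : 0 < 1 + 2 * a / t := by positivity
  have hη'0 : 0 < η' := by rw [hη']; positivity
  have hη'm : η' + a * (2 * η' / t) = η / 2 := by
    have : η' * (1 + 2 * a / t) = η / 2 := by rw [hη']; field_simp
    rw [← this]; ring
  have hnot : s + η' ∉ reach f z := fun h => by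
    have := le_csSup (bddAbove_reach f z) h
    rw [← hs] at this
    linarith
  -- below this `ε'`, the supremum is not exceeded by more than `η'`
  have hnot' : ∃ ε' > 0, ∀ S : X →L[𝕜] X, IsCompactOperator (S - 1 : X →L[𝕜] X) → ‖S‖ ≤ 1 + ε' →
      RCLike.re (z (adjointOp S f)) < s + η' := by
    by_contra! hcon
    exact hnot fun ε hε => hcon ε hε
  obtain ⟨ε', hε', hup⟩ := hnot'
  obtain ⟨ε, hεdef⟩ : ∃ ε, ε = min ε₁ (min ε' 1) / 3 := ⟨_, rfl⟩
  have hε0 : 0 < ε := by rw [hεdef]; positivity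
  have hε1 : 3 * ε ≤ ε₁ := by
    rw [hεdef, mul_div_cancel₀ _ three_ne_zero]; exact min_le_left _ _
  have hε2 : 3 * ε ≤ ε' := by
    rw [hεdef, mul_div_cancel₀ _ three_ne_zero]; exact (min_le_right _ _).trans (min_le_left _ _)
  have hε3 : 3 * ε ≤ 1 := by
    rw [hεdef, mul_div_cancel₀ _ three_ne_zero]; exact (min_le_right _ _).trans (min_le_right _ _)
  have hsub : s - η' ∈ reach f z := by
    obtain ⟨r, hr, hlt⟩ := exists_lt_of_lt_csSup ⟨_, re_apply_mem_reach f z⟩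
      (by linarith : s - η' < sSup (reach f z))
    exact reach_mono hr hlt.le
  obtain ⟨S, hS1, hS2, hS3⟩ := hsub ε hε0
  refine ⟨S, hS1, by linarith, ?_⟩
  rw [← hs]
  obtain ⟨f', hf'⟩ : ∃ f', f' = adjointOp S f := ⟨_, rfl⟩
  rw [← hf'] at hS3 ⊢
  have hf'n : ‖z‖ * ‖f'‖ ≤ D := by
    rw [hD, hf']
    refine mul_le_mul_of_nonneg_left ?_ z.opNorm_nonneg
    exact (ContinuousLinearMap.opNorm_comp_le f S).trans
      (mul_le_mul_of_nonneg_left (by linarith) f.opNorm_nonneg)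
  have hmax := norm_mul_norm_le_of_maximal (hn := hn) hP z f' (ε := ε) (η := 2 * η') ht0
    (by rw [← hC]; exact htC) hε0 fun S' hS'1 hS'2 => by
      have h1 := hup (S * S') (isCompactOperator_mul_sub_one hS1 hS'1) (by
        refine (norm_mul_le _ _).trans ((mul_le_mul hS2 hS'2 (norm_nonneg _)
          (by linarith)).trans ?_)
        nlinarith)
      rw [adjointOp_mul, ← hf'] at h1
      linarith
  rw [← hC] at hmax
  have hw' : RCLike.re (w f') ≤ ‖z‖ * ‖f'‖ :=
    (RCLike.re_le_norm _).trans ((w.le_opNorm f').trans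
      (mul_le_mul_of_nonneg_right hw f'.opNorm_nonneg))
  have hrem : 2 * t * C ^ 2 * (‖z‖ * ‖f'‖) ≤ 2 * t * C ^ 2 * D := by gcongr
  have hz' : RCLike.re ((z + a • (z - defect hn P z - w)) f') = RCLike.re (z f')
      + a * (RCLike.re (z f') - RCLike.re (defect hn P z f') - RCLike.re (w f')) := by
    rw [add_apply, smul_apply, map_add, RCLike.smul_re, sub_apply, sub_apply, map_sub, map_sub]
  rw [hz']
  have h1 : -(2 * η' / t + 2 * t * C ^ 2 * D) ≤
      RCLike.re (z f') - RCLike.re (defect hn P z f') - RCLike.re (w f') := by linarith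
  have h2 := mul_le_mul_of_nonneg_left h1 ha
  linarith

theorem finiteDimensional_of_isometry {V : Type*} [SeminormedAddCommGroup V] [NormedSpace 𝕜 V]
    [NormedSpace ℝ V] [IsScalarTower ℝ 𝕜 V] (h : FiniteDimensional ℝ V) (i : X →ₗᵢ[𝕜] V) :
    FiniteDimensional 𝕜 X := by
  have h1 : Module.Finite 𝕜 V := Module.Finite.of_restrictScalars_finite ℝ 𝕜 V
  exact Module.Finite.of_injective i.toLinearMap i.injective

theorem not_finiteDimensional_bidual (hX : ¬ FiniteDimensional 𝕜 X) :
    ¬ FiniteDimensional ℝ (StrongDual 𝕜 (StrongDual 𝕜 X)) := by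
  intro h
  have h1 := @finiteDimensional_of_isometry 𝕜 X _ _ _ (StrongDual 𝕜 (StrongDual 𝕜 X)) _ _ _ _ h
  exact hX (h1 (NormedSpace.inclusionInDoubleDualLi 𝕜))

/-- The case of `X**` in `le_of_transport`, for an operator that is linear over `𝕜`. -/
theorem le_of_transport_bidual (hX : ¬ FiniteDimensional 𝕜 X)
    (B : StrongDual 𝕜 (StrongDual 𝕜 X) →L[𝕜] StrongDual 𝕜 (StrongDual 𝕜 X))
    (hB : ∀ (a : ℝ) z, ‖z‖ ≤ ‖z + a • B z‖) (σ : StrongDual 𝕜 (StrongDual 𝕜 X) → ℝ)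
    (h0 : ∀ z, 0 ≤ σ z) (h1 : ∀ z (c : ℝ), 0 < c → σ (c • z) = c * σ z)
    (h2 : ∀ z w (a : ℝ), 0 ≤ a → ‖w‖ ≤ ‖z‖ → σ z ≤ σ (z + a • (z - B z - w)))
    {z₀ z₁ : StrongDual 𝕜 (StrongDual 𝕜 X)} (hz₀ : ‖z₀‖ = 1) (hz₁ : ‖z₁‖ = 1) :
    σ z₁ ≤ σ z₀ := by
  have hZ := not_finiteDimensional_bidual hX
  exact le_of_transport hZ (B.restrictScalars ℝ) (fun a z => hB a z) σ h0 h1 h2 hz₀ hz₁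

theorem norm_le_reachSup [CompleteSpace X] (hX : ¬ FiniteDimensional 𝕜 X)
    (hn : 0 < numIndex 𝕜 X) (hP : IsLProjection (compactV 𝕜 X) P)
    (z : StrongDual 𝕜 (StrongDual 𝕜 X)) (f : StrongDual 𝕜 X) (hz : ‖z‖ = 1) (hf : 0 < ‖f‖) :
    ‖f‖ ≤ reachSup f z := by
  obtain ⟨z₁, hz₁, hz₁f⟩ : ∃ z₁ : StrongDual 𝕜 (StrongDual 𝕜 X), ‖z₁‖ = 1 ∧ z₁ f = ‖f‖ :=
    exists_dual_vector 𝕜 f hf.ne'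
  have h1 := @le_of_transport_bidual 𝕜 X _ _ _ hX (defect hn P)
  have h2 := h1 (fun a z => norm_le_norm_add_smul_defect hP a z) (reachSup f)
    (fun z => le_max_left _ _) (fun z c hc => reachSup_smul f z hc)
    (fun z w a ha hw => reachSup_le_transport hP f z w ha hw) hz hz₁
  refine le_trans ?_ h2
  refine le_max_of_le_right (le_csSup (bddAbove_reach f z₁) ?_)
  have := re_apply_mem_reach f z₁
  rwa [hz₁f, RCLike.ofReal_re] at this

theorem norm_mul_norm_le_reachSup [CompleteSpace X] (hX : ¬ FiniteDimensional 𝕜 X)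
    (hn : 0 < numIndex 𝕜 X) (hP : IsLProjection (compactV 𝕜 X) P)
    (z : StrongDual 𝕜 (StrongDual 𝕜 X)) (f : StrongDual 𝕜 X) (hz : 0 < ‖z‖) (hf : 0 < ‖f‖) :
    ‖z‖ * ‖f‖ ≤ reachSup f z := by
  have hu : ‖(‖z‖⁻¹ : ℝ) • z‖ = 1 := by
    have h := @norm_smul_of_nonneg (StrongDual 𝕜 (StrongDual 𝕜 X)) _ _ ‖z‖⁻¹
    rw [h (inv_nonneg.mpr hz.le) z, inv_mul_cancel₀ hz.ne']
  have h := norm_le_reachSup hX hn hP _ f hu hf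
  rw [reachSup_smul f z (inv_pos.mpr hz), inv_mul_eq_div, le_div_iff₀ hz, mul_comm] at h
  exact h

/-- Compact perturbations of the identity with norm almost one align every `f ∈ X*` with every
`z ∈ X**`. In finite dimension a rank one operator does so; in infinite dimension `reachSup f` is
constant on the unit sphere of `X**`, and it is at least `‖f‖` at a functional norming `f`. -/
theorem exists_re_apply_adjointOp_ge [CompleteSpace X] (hn : 0 < numIndex 𝕜 X)
    (hP : IsLProjection (compactV 𝕜 X) P) (z : StrongDual 𝕜 (StrongDual 𝕜 X))
    (f : StrongDual 𝕜 X) {ε : ℝ} (hε : 0 < ε) :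
    ∃ S : X →L[𝕜] X, IsCompactOperator (S - 1 : X →L[𝕜] X) ∧ ‖S‖ ≤ 1 + ε ∧
      ‖z‖ * ‖f‖ - ε ≤ RCLike.re (z (adjointOp S f)) := by
  by_cases hX : FiniteDimensional 𝕜 X
  · by_contra! hcon
    have : ProperSpace X := FiniteDimensional.proper 𝕜 X
    have h : ‖z‖ * ‖f‖ ≤ ‖z‖ * ‖f‖ - ε := mul_norm_le_of_forall fun g x hg hx => by
      have h1 := hcon (rankOne g x) (isCompactOperator_of_locallyCompactSpace_dom _) (by
        rw [norm_rankOne]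
        exact (mul_le_one₀ hg (norm_nonneg _) hx).trans (by linarith))
      rw [adjointOp_rankOne, map_smul, smul_eq_mul, mul_comm] at h1
      exact h1.le
    linarith
  · rcases z.opNorm_nonneg.eq_or_lt with hz | hz
    · refine ⟨1, by rw [sub_self]; exact isCompactOperator_zero,
        ContinuousLinearMap.norm_id_le.trans (by linarith), ?_⟩
      have h1 := (abs_le.mp ((RCLike.abs_re_le_norm (z f)).trans (z.le_opNorm f))).1
      rw [adjointOp_one]
      rw [← hz, zero_mul] at h1 ⊢
      linarith
    rcases f.opNorm_nonneg.eq_or_lt with hf | hf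
    · refine ⟨1, by rw [sub_self]; exact isCompactOperator_zero,
        ContinuousLinearMap.norm_id_le.trans (by linarith), ?_⟩
      have h1 := (abs_le.mp ((RCLike.abs_re_le_norm (z f)).trans (z.le_opNorm f))).1
      rw [adjointOp_one]
      rw [← hf, mul_zero] at h1 ⊢
      linarith
    have h := norm_mul_norm_le_reachSup hX hn hP z f hz hf
    have hpos : 0 < ‖z‖ * ‖f‖ := mul_pos hz hf
    have h' : ‖z‖ * ‖f‖ ≤ sSup (reach f z) := by
      rcases le_max_iff.mp h with h | h
      · linarith
      · exact h
    obtain ⟨r, hr, hlt⟩ := exists_lt_of_lt_csSup ⟨_, re_apply_mem_reach f z⟩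
      (by linarith : ‖z‖ * ‖f‖ - ε < sSup (reach f z))
    obtain ⟨S, h1, h2, h3⟩ := hr ε hε
    exact ⟨S, h1, h2, hlt.le.trans h3⟩

end Alignment

open Filter Topology

/-! ### Limits of states -/

section Limits

variable {𝕜 V ι : Type*} [RCLike 𝕜] [SeminormedAddCommGroup V] [NormedSpace 𝕜 V]

/-- Weak-* compactness of the dual unit ball, in terms of a single ultrafilter. -/
theorem exists_tendsto_apply (U : Ultrafilter ι) (φ : ι → StrongDual 𝕜 V)
    (h : ∀ i, ‖φ i‖ ≤ 1) :
    ∃ ψ : StrongDual 𝕜 V, ‖ψ‖ ≤ 1 ∧ ∀ v, Tendsto (fun i => φ i v) U (𝓝 (ψ v)) := by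
  have hb : ∀ v i, φ i v ∈ Metric.closedBall (0 : 𝕜) ‖v‖ := fun v i => by
    rw [mem_closedBall_zero_iff]
    exact ((φ i).le_opNorm v).trans (mul_le_of_le_one_left (norm_nonneg v) (h i))
  have hlim : ∀ v, ∃ c ∈ Metric.closedBall (0 : 𝕜) ‖v‖, Tendsto (fun i => φ i v) U (𝓝 c) :=
    fun v => (isCompact_closedBall (0 : 𝕜) ‖v‖).ultrafilter_le_nhds' (U.map fun i => φ i v)
      (Filter.mem_map.mpr (Filter.univ_mem' (hb v)))
  choose ℓ hℓ hℓ' using hlim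
  refine ⟨LinearMap.mkContinuous
    { toFun := ℓ
      map_add' := fun v w => tendsto_nhds_unique (hℓ' (v + w)) (by
        simpa only [map_add] using (hℓ' v).add (hℓ' w))
      map_smul' := fun c v => tendsto_nhds_unique (hℓ' (c • v)) (by
        simpa only [map_smul, RingHom.id_apply] using (hℓ' v).const_smul c) } 1 fun v => ?_,
    LinearMap.mkContinuous_norm_le _ zero_le_one _, hℓ'⟩
  rw [one_mul]
  exact mem_closedBall_zero_iff.mp (hℓ v)

end Limits

section Main

variable {𝕜 X : Type*} [RCLike 𝕜] [NormedAddCommGroup X] [NormedSpace 𝕜 X]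

theorem statePairs_nonempty [Nontrivial X] : (statePairs 𝕜 X).Nonempty := by
  let _ : NormedSpace ℝ X := NormedSpace.restrictScalars ℝ 𝕜 X
  obtain ⟨x, hx⟩ := exists_norm_eq X zero_le_one
  obtain ⟨g, hg⟩ := exists_statePair (𝕜 := 𝕜) x hx
  exact ⟨_, hg⟩

theorem exists_tendsto_numRadius [Nontrivial X] (T : X →L[𝕜] X) :
    ∃ q : ℕ → StrongDual 𝕜 X × X, (∀ n, q n ∈ statePairs 𝕜 X) ∧
      Tendsto (fun n => ‖(q n).1 (T (q n).2)‖) atTop (𝓝 (numRadius T)) := by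
  obtain ⟨u, -, hu, hmem⟩ := exists_seq_tendsto_sSup
    ((statePairs_nonempty (𝕜 := 𝕜) (X := X)).image
      fun q : StrongDual 𝕜 X × X => ‖q.1 (T q.2)‖) (bddAbove_numRadius T)
  choose q hq hqu using hmem
  refine ⟨q, hq, ?_⟩
  have : (fun n => ‖(q n).1 (T (q n).2)‖) = u := funext hqu
  rw [this]
  exact hu

theorem norm_dualTensor_inclusion_le (hn : 0 < numIndex 𝕜 X) {q : StrongDual 𝕜 X × X}
    (hq : q ∈ statePairs 𝕜 X) :
    ‖dualTensor hn (NormedSpace.inclusionInDoubleDual 𝕜 X q.2) q.1‖ ≤ 1 :=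
  ContinuousLinearMap.opNorm_le_bound _ zero_le_one fun T => by
    rw [one_mul]
    exact le_numRadius hq _

/-- Weak-* limits of states `(x*, x)` along which `|x* (T x)|` tends to `v(T)`. On compact operators
the limit functional is `z ⊗ f`, because `K x` converges in norm along the ultrafilter. -/
theorem exists_limit_state [Nontrivial X] (hn : 0 < numIndex 𝕜 X) (T : OpV 𝕜 X) :
    ∃ (Φ : StrongDual 𝕜 (OpV 𝕜 X)) (z : StrongDual 𝕜 (StrongDual 𝕜 X)) (f : StrongDual 𝕜 X),
      ‖Φ‖ ≤ 1 ∧ Φ (idV 𝕜 X) = 1 ∧ ‖Φ T‖ = ‖T‖ ∧ ‖z‖ ≤ 1 ∧ ‖f‖ ≤ 1 ∧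
      ∀ K ∈ compactV 𝕜 X, Φ K = dualTensor hn z f K := by
  obtain ⟨q, hq, hqT⟩ := exists_tendsto_numRadius (toOp 𝕜 X T)
  obtain ⟨U, hU⟩ : ∃ U : Ultrafilter ℕ, (U : Filter ℕ) ≤ atTop :=
    ⟨hyperfilter ℕ, Nat.hyperfilter_le_atTop⟩
  obtain ⟨Φ, hΦ1, hΦ⟩ := exists_tendsto_apply U
    (fun n => dualTensor hn (NormedSpace.inclusionInDoubleDual 𝕜 X (q n).2) (q n).1)
    fun n => norm_dualTensor_inclusion_le hn (hq n)
  obtain ⟨f, hf1, hf⟩ := exists_tendsto_apply U (fun n => (q n).1) fun n => (hq n).1.le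
  obtain ⟨z, hz1, hz⟩ := exists_tendsto_apply U
    (fun n => NormedSpace.inclusionInDoubleDual 𝕜 X (q n).2) fun n =>
      (NormedSpace.double_dual_bound 𝕜 X (q n).2).trans (hq n).2.1.le
  refine ⟨Φ, z, f, hΦ1, ?_, ?_, hz1, hf1, fun K hK => ?_⟩
  · refine tendsto_nhds_unique (hΦ (idV 𝕜 X)) ?_
    have : ∀ n, dualTensor hn (NormedSpace.inclusionInDoubleDual 𝕜 X (q n).2) (q n).1
        (idV 𝕜 X) = 1 := fun n => (hq n).2.2
    simp only [this]
    exact tendsto_const_nhds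
  · exact tendsto_nhds_unique (hΦ T).norm (hqT.mono_left hU)
  · obtain ⟨K', hK'⟩ : ∃ K' : X →L[𝕜] X, K' = toOp 𝕜 X K := ⟨_, rfl⟩
    have hKc : IsCompactOperator K' := hK' ▸ hK
    obtain ⟨M, hM, hKM⟩ := hKc.image_closedBall_subset_compact 1
    obtain ⟨y, -, hy⟩ := hM.ultrafilter_le_nhds' (U.map fun n => K' (q n).2)
      (Filter.mem_map.mpr (Filter.univ_mem' fun n => hKM ⟨(q n).2, by
        rw [mem_closedBall_zero_iff]; exact (hq n).2.1.le, rfl⟩))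
    have hy' : Tendsto (fun n => K' (q n).2) U (𝓝 y) := hy
    have hzy : z (adjointOp K' f) = f y :=
      tendsto_nhds_unique (hz (adjointOp K' f)) ((f.continuous.tendsto y).comp hy')
    have h0 : Tendsto (fun n => (q n).1 (K' (q n).2 - y)) U (𝓝 0) := by
      refine squeeze_zero_norm (a := fun n => ‖K' (q n).2 - y‖) (fun n => ?_) ?_
      · refine ((q n).1.le_opNorm _).trans ?_
        rw [(hq n).1, one_mul]
      · have := (hy'.sub_const y).norm
        rwa [sub_self, norm_zero] at this
    have h1 := h0.add (hf y)
    rw [zero_add] at h1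
    rw [dualTensor_apply, ← hK', hzy]
    refine tendsto_nhds_unique (hΦ K) (h1.congr fun n => ?_)
    rw [← map_add, sub_add_cancel, hK']
    rfl

/-! ### Attainment for the adjoint -/

theorem numRadius_eq_essNumRadius_iff (T : X →L[𝕜] X) :
    numRadius T = essNumRadius T ↔
      ∀ K : X →L[𝕜] X, IsCompactOperator K → numRadius T ≤ numRadius (T - K) := by
  have hbdd : BddBelow ((fun K : X →L[𝕜] X => numRadius (T - K)) '' {K | IsCompactOperator K}) :=
    ⟨0, by rintro _ ⟨K, -, rfl⟩; exact numRadius_nonneg _⟩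
  refine ⟨fun h K hK => h.le.trans (csInf_le hbdd ⟨K, hK, rfl⟩), fun h => le_antisymm ?_ ?_⟩
  · refine le_csInf ⟨_, 0, isCompactOperator_zero, rfl⟩ ?_
    rintro _ ⟨K, hK, rfl⟩
    exact h K hK
  · refine csInf_le hbdd ⟨0, isCompactOperator_zero, ?_⟩
    simp only [sub_zero]

/-- Homogeneous form of `norm_apply_adjointOp_le_numRadius`, for aligned `z` and `f`. -/
theorem norm_apply_adjointOp_le_mul_numRadius (K : X →L[𝕜] X)
    {z : StrongDual 𝕜 (StrongDual 𝕜 X)} {f : StrongDual 𝕜 X}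
    (hzf : z f = ((‖z‖ * ‖f‖ : ℝ) : 𝕜)) :
    ‖z (adjointOp K f)‖ ≤ ‖z‖ * ‖f‖ * numRadius K := by
  have h0 := norm_apply_adjointOp_le_mul z K f
  rcases z.opNorm_nonneg.eq_or_lt with hz | hz
  · rw [← hz, zero_mul] at h0 ⊢
    rwa [zero_mul]
  rcases f.opNorm_nonneg.eq_or_lt with hf | hf
  · rw [← hf, zero_mul, mul_zero] at h0
    rwa [← hf, mul_zero, zero_mul]
  have hcz : ‖((‖z‖⁻¹ : ℝ) : 𝕜)‖ = ‖z‖⁻¹ := by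
    rw [RCLike.norm_ofReal, abs_of_pos (inv_pos.mpr hz)]
  have hcf : ‖((‖f‖⁻¹ : ℝ) : 𝕜)‖ = ‖f‖⁻¹ := by
    rw [RCLike.norm_ofReal, abs_of_pos (inv_pos.mpr hf)]
  have hadj : adjointOp K (((‖f‖⁻¹ : ℝ) : 𝕜) • f) = ((‖f‖⁻¹ : ℝ) : 𝕜) • adjointOp K f :=
    map_smul _ _ _
  have h := norm_apply_adjointOp_le_numRadius K (z := ((‖z‖⁻¹ : ℝ) : 𝕜) • z)
    (f := ((‖f‖⁻¹ : ℝ) : 𝕜) • f)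
    (ContinuousLinearMap.opNorm_le_bound _ zero_le_one fun g => by
      rw [smul_apply, norm_smul, hcz, inv_mul_eq_div, div_le_iff₀ hz, one_mul, mul_comm]
      exact z.le_opNorm g)
    (by rw [norm_smul, hcf, inv_mul_cancel₀ hf.ne'])
    (by
      rw [smul_apply, map_smul, hzf, smul_eq_mul, smul_eq_mul, ← RCLike.ofReal_mul,
        ← RCLike.ofReal_mul, ← RCLike.ofReal_one]
      congr 1
      field_simp)
  rw [smul_apply, hadj, map_smul, norm_smul, norm_smul, hcz, hcf] at h
  calc ‖z (adjointOp K f)‖ = ‖z‖ * ‖f‖ * (‖z‖⁻¹ * (‖f‖⁻¹ * ‖z (adjointOp K f)‖)) := by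
        field_simp
    _ ≤ _ := mul_le_mul_of_nonneg_left h (mul_pos hz hf).le

variable {P : StrongDual 𝕜 (OpV 𝕜 X) →L[𝕜] StrongDual 𝕜 (OpV 𝕜 X)}

/-- The limits `z` and `f` of a family of states are aligned: for `S = 1 + C` with `C` compact,
`Φ (S) = 1 + z (S* f) - z f`, whose real part is at most `‖S‖`. Taking for `S` the operators of
`exists_re_apply_adjointOp_ge` gives `‖z‖ ‖f‖ ≤ Re (z f)`. -/
theorem apply_eq_norm_mul_norm [CompleteSpace X] (hn : 0 < numIndex 𝕜 X)
    (hP : IsLProjection (compactV 𝕜 X) P) {Φ : StrongDual 𝕜 (OpV 𝕜 X)}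
    {z : StrongDual 𝕜 (StrongDual 𝕜 X)} {f : StrongDual 𝕜 X} (hΦ : ‖Φ‖ ≤ 1)
    (hΦ1 : Φ (idV 𝕜 X) = 1) (hΦK : ∀ K ∈ compactV 𝕜 X, Φ K = dualTensor hn z f K) :
    z f = ((‖z‖ * ‖f‖ : ℝ) : 𝕜) := by
  have hle : ‖z f‖ ≤ ‖z‖ * ‖f‖ := z.le_opNorm f
  have hge : ‖z‖ * ‖f‖ ≤ RCLike.re (z f) := by
    refine le_of_forall_pos_sub_le fun δ hδ => ?_
    obtain ⟨S, hS, hS1, hSz⟩ := exists_re_apply_adjointOp_ge hn hP z f (half_pos hδ)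
    obtain ⟨C, hC⟩ : ∃ C : OpV 𝕜 X, C = (toOp 𝕜 X).symm (S - 1) := ⟨_, rfl⟩
    have hCJ : C ∈ compactV 𝕜 X := by rw [hC]; exact hS
    have h1 : Φ (idV 𝕜 X + C) = 1 + (z (adjointOp S f) - z f) := by
      rw [map_add, hΦ1, hΦK C hCJ, hC, dualTensor_apply, LinearEquiv.apply_symm_apply,
        adjointOp_sub, map_sub, adjointOp_one]
    have h2 : ‖idV 𝕜 X + C‖ ≤ ‖S‖ := by
      have e : toOp 𝕜 X (idV 𝕜 X + C) = S := by
        rw [map_add, hC, LinearEquiv.apply_symm_apply, toOp_idV, add_sub_cancel]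
      have := numRadius_le_norm (toOp 𝕜 X (idV 𝕜 X + C))
      rw [e] at this
      rw [opV_norm_def, e]
      exact this
    have h3 : RCLike.re (Φ (idV 𝕜 X + C)) ≤ 1 + δ / 2 :=
      (RCLike.re_le_norm _).trans ((Φ.le_opNorm _).trans
        ((mul_le_of_le_one_left (norm_nonneg _) hΦ).trans (h2.trans hS1)))
    rw [h1, map_add, map_sub, RCLike.one_re] at h3
    linarith
  have h := RCLike.re_eq_self_of_le (hle.trans hge)
  rw [← h]
  congr 1
  exact le_antisymm ((RCLike.re_le_norm _).trans hle) hge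

/-- With `Φ` the limit of states of `exists_limit_state`: if `P Φ ≠ 0`, then `v(T) = v_e(T)`; if
`P Φ = 0`, then the limits `z`, `f` form a state of `X*` at which `T*` attains its numerical
radius. -/
theorem numRadius_eq_essNumRadius_of_not_attains [CompleteSpace X] [Nontrivial X]
    (hn : 0 < numIndex 𝕜 X) (hP : IsLProjection (compactV 𝕜 X) P) (T : OpV 𝕜 X)
    (hT : ¬ AttainsNumRadius (adjointOp (toOp 𝕜 X T))) :
    numRadius (toOp 𝕜 X T) = essNumRadius (toOp 𝕜 X T) := by
  obtain ⟨Φ, z, f, hΦ, hΦ1, hΦT, hz, hf, hΦK⟩ := exists_limit_state hn T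
  have hΦn : ‖Φ‖ = 1 := by
    refine le_antisymm hΦ ?_
    have := (Φ.le_opNorm (idV 𝕜 X)).trans (mul_le_of_le_one_right (norm_nonneg _) norm_idV_le)
    rwa [hΦ1, norm_one] at this
  have hsplit := hP.norm_eq Φ
  rcases (norm_nonneg (P Φ)).eq_or_lt with hb | hb
  · exfalso
    have hPΦ : P Φ = 0 := by
      ext S
      have := (P Φ).le_opNorm S
      rw [← hb, zero_mul] at this
      exact norm_le_zero_iff.mp this
    have hzf := apply_eq_norm_mul_norm hn hP hΦ hΦ1 hΦK
    have hr : 1 ≤ ‖z‖ * ‖f‖ := by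
      rw [← hΦn]
      refine hP.norm_le_of_bound hPΦ (mul_nonneg z.opNorm_nonneg f.opNorm_nonneg) fun K hK => ?_
      rw [hΦK K hK]
      exact norm_apply_adjointOp_le_mul_numRadius _ hzf
    have hz1 : ‖z‖ = 1 := le_antisymm hz
      (hr.trans (mul_le_of_le_one_right z.opNorm_nonneg hf))
    have hf1 : ‖f‖ = 1 := le_antisymm hf
      (hr.trans (mul_le_of_le_one_left f.opNorm_nonneg hz))
    have hzf1 : z f = 1 := by rw [hzf, hz1, hf1, one_mul, RCLike.ofReal_one]
    -- both functionals have norm at most one and agree on the compact operators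
    have hten : dualTensor hn z f = Φ := by
      refine hP.eq_of_eqOn hPΦ (fun K hK => (hΦK K hK).symm) ?_
      rw [hΦn]
      refine ContinuousLinearMap.opNorm_le_bound _ zero_le_one fun S => ?_
      rw [one_mul]
      exact norm_apply_adjointOp_le_numRadius _ hz hf hzf1
    refine hT ⟨(z, f), ⟨hz1, hf1, hzf1⟩, ?_⟩
    rw [numRadius_adjointOp, ← opV_norm_def, ← hΦT, ← hten]
    rfl
  · refine (numRadius_eq_essNumRadius_iff _).mpr fun K hK => ?_
    obtain ⟨K', hK'⟩ : ∃ K' : OpV 𝕜 X, K' = (toOp 𝕜 X).symm K := ⟨_, rfl⟩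
    have hKJ : K' ∈ compactV 𝕜 X := by rw [hK']; exact hK
    have h1 : Φ T = P Φ (T - K') + (Φ - P Φ) T := by
      rw [map_sub, hP.apply_eq_zero Φ hKJ, sub_zero, sub_apply, add_sub_cancel]
    have h2 : ‖T‖ ≤ ‖P Φ‖ * ‖T - K'‖ + ‖Φ - P Φ‖ * ‖T‖ := by
      rw [← hΦT, h1]
      refine (norm_add_le _ _).trans (add_le_add ((P Φ).le_opNorm _) ?_)
      rw [← h1, hΦT]
      exact (Φ - P Φ).le_opNorm T
    -- the part of `Φ` in the kernel of `P` contributes at most `(1 - ‖P Φ‖) v(T)`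
    have h3 : ‖P Φ‖ * ‖T‖ ≤ ‖P Φ‖ * ‖T - K'‖ := by
      have : ‖Φ - P Φ‖ = 1 - ‖P Φ‖ := by linarith
      rw [this] at h2
      linarith
    have h4 := le_of_mul_le_mul_left h3 hb
    rw [hK'] at h4
    exact h4

/-! ### Nowhere density -/

theorem isClosed_setOf_norm_le_norm_sub (J : Submodule 𝕜 (OpV 𝕜 X)) :
    IsClosed {T : OpV 𝕜 X | ∀ K ∈ J, ‖T‖ ≤ ‖T - K‖} := by
  simp only [Set.ofPred_forall]
  exact isClosed_biInter fun K _ =>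
    isClosed_le continuous_norm (continuous_id.sub continuous_const).norm

/-- At a state `(x*, x)` that almost realises `v(T)`, a small multiple of the rank one operator
`x* ⊗ x`, rotated to have the phase of `x* (T x)`, increases the numerical radius. -/
theorem exists_compact_norm_le_norm_add_gt [Nontrivial X] (T : OpV 𝕜 X) {δ : ℝ} (hδ : 0 < δ) :
    ∃ K ∈ compactV 𝕜 X, ‖K‖ ≤ δ ∧ ‖T‖ < ‖T + K‖ := by
  obtain ⟨_, ⟨q, hq, rfl⟩, hlt⟩ := exists_lt_of_lt_csSup
    ((statePairs_nonempty (𝕜 := 𝕜) (X := X)).image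
      fun q : StrongDual 𝕜 X × X => ‖q.1 (toOp 𝕜 X T q.2)‖)
    (show numRadius (toOp 𝕜 X T) - δ < sSup _ from sub_lt_self _ hδ)
  dsimp only at hlt
  obtain ⟨c, hc, hca⟩ := RCLike.exists_norm_eq_mul_self (q.1 (toOp 𝕜 X T q.2))
  have hc0 : c ≠ 0 := fun h => by rw [h, norm_zero] at hc; exact zero_ne_one hc
  obtain ⟨K, hK⟩ : ∃ K : X →L[𝕜] X, K = (δ * c⁻¹ : 𝕜) • rankOne q.1 q.2 := ⟨_, rfl⟩
  have hKn : ‖K‖ ≤ δ := by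
    rw [hK, norm_smul, norm_rankOne, hq.1, hq.2.1, norm_mul, norm_inv, hc, RCLike.norm_ofReal,
      abs_of_pos hδ]
    simp
  have hKq : q.1 (K q.2) = δ * c⁻¹ := by
    rw [hK, smul_apply, rankOne_apply, hq.2.2, one_smul, map_smul, hq.2.2, smul_eq_mul, mul_one]
  refine ⟨(toOp 𝕜 X).symm K, ?_, (numRadius_le_norm K).trans hKn, ?_⟩
  · change IsCompactOperator K
    rw [hK]
    exact (isCompactOperator_rankOne _ _).smul _
  have h1 : ‖q.1 ((toOp 𝕜 X T + K) q.2)‖ = ‖q.1 (toOp 𝕜 X T q.2)‖ + δ := by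
    calc ‖q.1 ((toOp 𝕜 X T + K) q.2)‖ = ‖c * q.1 ((toOp 𝕜 X T + K) q.2)‖ := by
          rw [norm_mul, hc, one_mul]
      _ = ‖((‖q.1 (toOp 𝕜 X T q.2)‖ + δ : ℝ) : 𝕜)‖ := by
          rw [add_apply, map_add, hKq, mul_add, ← hca, mul_left_comm, mul_inv_cancel₀ hc0,
            mul_one, RCLike.ofReal_add]
      _ = _ := by rw [RCLike.norm_ofReal, abs_of_nonneg (by positivity)]
  have h2 := le_numRadius hq (toOp 𝕜 X T + K)
  rw [h1] at h2
  change numRadius (toOp 𝕜 X T) < numRadius (toOp 𝕜 X T + K)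
  linarith

theorem isNowhereDense_setOf_norm_le_norm_sub [Nontrivial X] :
    IsNowhereDense {T : OpV 𝕜 X | ∀ K ∈ compactV 𝕜 X, ‖T‖ ≤ ‖T - K‖} := by
  rw [(isClosed_setOf_norm_le_norm_sub _).isNowhereDense_iff, Set.eq_empty_iff_forall_notMem]
  intro T hT
  obtain ⟨δ, hδ, hball⟩ := Metric.mem_nhds_iff.mp (mem_interior_iff_mem_nhds.mp hT)
  obtain ⟨K, hK, hKδ, hlt⟩ := exists_compact_norm_le_norm_add_gt T (half_pos hδ)
  have hmem : T + K ∈ Metric.ball T δ := by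
    rw [mem_ball_iff_norm, add_sub_cancel_left]
    linarith
  have := hball hmem K hK
  rw [add_sub_cancel_right] at this
  exact hlt.not_ge this

end Main

end NumericalRadius

end

theorem mainTheorem3 {𝕜 X : Type*} [RCLike 𝕜] [NormedAddCommGroup X] [NormedSpace 𝕜 X]
    [CompleteSpace X] [Nontrivial X]
    (hn : 0 < numIndex 𝕜 X) (hM : IsMIdeal (compactV 𝕜 X)) :
    (∀ T : OpV 𝕜 X, ¬ AttainsNumRadius (adjointOp (toOp 𝕜 X T)) →
      numRadius (toOp 𝕜 X T) = essNumRadius (toOp 𝕜 X T)) ∧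
    IsNowhereDense {T : OpV 𝕜 X | ¬ AttainsNumRadius (adjointOp (toOp 𝕜 X T))} := by
  obtain ⟨-, P, hidem, hnorm, hrange⟩ := hM
  have hP : IsLProjection (compactV 𝕜 X) P := ⟨hidem, hnorm, hrange⟩
  refine ⟨numRadius_eq_essNumRadius_of_not_attains hn hP,
    IsNowhereDense.mono ?_ (isNowhereDense_setOf_norm_le_norm_sub (𝕜 := 𝕜) (X := X))⟩
  intro T hT K hK
  exact (numRadius_eq_essNumRadius_iff _).mp
    (numRadius_eq_essNumRadius_of_not_attains hn hP T hT) (toOp 𝕜 X K) hK
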